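/- **Theorem 3.3 (free $\mathcal D$-convex Banach lattices).** All spaces are real. For $m\ge 1$ let $\mathcal H_m$ be the vector lattice of continuous functions $h\colon\mathbb R^m\to\mathbb R$ that are positively homogeneous, i.e. $h(ct)=c\,h(t)$ for $c\ge 0$, and let $\mathcal H_m^{>0}$ be the set of those $h\in\mathcal H_m$ with $h(t)\le h(s)$ whenever $0\le t_k\le s_k$ for all $k$. For elements $x_1,\dots,x_m$ of an Archimedean vector lattice $X$ there is at most one linear lattice homomorphism $\Phi\colon\mathcal H_m\to X$ that sends the $k$-th coordinate function to $x_k$ for each $k$; it always exists when $X$ is a Banach lattice, and one writes $h(x_1,\dots,x_m)=\Phi(h)$. In a vector lattice of functions closed under these operations, $h(x_1,\dots,x_m)$ is computed pointwise. A *convexity condition* is a triple $\mathcal D=(\mathcal G,M,\vartheta)$ consisting of a non-empty set $\mathcal G\subseteq\bigcup_{m\ge 1}\mathcal H_m^{>0}$ and functions $M\colon\mathcal G\to[1,\infty)$, $\vartheta\colon\mathcal G\to\{0,1\}$. A lattice seminorm $\nu$ on an Archimedean vector lattice $X$ in which all elements $h(x_1,\dots,x_m)$ exist (a seminorm with $\nu(x)\le\nu(y)$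 whenever $|x|\le|y|$) is *$\mathcal D$-convex* if, for all $m\ge 1$ and $g\in\mathcal G\cap\mathcal H_m^{>0}$, $$\nu\bigl(g(x_1,\dots,x_m)\bigr)\le M(g)\,g\bigl(\nu(x_1),\dots,\nu(x_m)\bigr)$$ for all $x_1,\dots,x_m\in X_+$ if $\vartheta(g)=1$, and for all pairwise disjoint $x_1,\dots,x_m\in X_+$ if $\vartheta(g)=0$. A Banach lattice is $\mathcal D$-convex if its norm is. Let $E$ be a Banach space and $\mathcal D$ a convexity condition. Then there are a $\mathcal D$-convex Banach lattice $\mathrm{FBL}^{\mathcal D}[E]$ and a linear isometry (not necessarily onto) $\phi_E\colon E\to\mathrm{FBL}^{\mathcal D}[E]$ with the following properties. 1. For every $\mathcal D$-convex Banach lattice $X$ and every bounded linear operator $T\colon E\to X$ there is a unique linear lattice homomorphism $\widehat T\colon\mathrm{FBL}^{\mathcal D}[E]\to X$ with $\widehat T\circ\phi_E=T$. Moreover, $\widehat T$ is bounded and $\|\widehat T\|=\|T\|$. 2. Let $B_{E^*}$ be the closed unit ball of the dual space of $E$, let $\delta_x\colon B_{E^*}\to\mathbb R$, $\delta_x(x^*)=x^*(x)$,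 for $x\in E$, and let $Y_0$ be the vector lattice (with pointwise operations) of all functions $x^*\mapsto h(\delta_{x_1}(x^*),\dots,\delta_{x_m}(x^*))$ on $B_{E^*}$ with $m\ge 1$, $h\in\mathcal H_m$ and $x_1,\dots,x_m\in E$. Among the $\mathcal D$-convex lattice seminorms $\nu$ on $Y_0$ with $\nu(\delta_x)\le\|x\|$ for all $x\in E$ there is a largest one, it is a norm, and $\mathrm{FBL}^{\mathcal D}[E]$ is the completion of $Y_0$ in this norm, with $\phi_E(x)=\delta_x$: there is an injective linear lattice homomorphism $\iota\colon Y_0\to\mathrm{FBL}^{\mathcal D}[E]$ with dense range such that $\iota(\delta_x)=\phi_E(x)$ for all $x\in E$, and $f\mapsto\|\iota(f)\|$ is that largest seminorm. -/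

import Mathlib

universe u v

/-- A (real) Banach lattice: a vector lattice with a complete norm such that `|x| ≤ |y|` implies
`‖x‖ ≤ ‖y‖`. -/
class BanachLattice (X : Type*) [NormedAddCommGroup X] [NormedSpace ℝ X] [Lattice X] : Prop
    extends IsOrderedAddMonoid X, IsOrderedModule ℝ X, HasSolidNorm X, CompleteSpace X

/-- Linear lattice homomorphisms between vector lattices. -/
structure IsLatticeHom {X Y : Type*} [AddCommGroup X] [Module ℝ X] [Lattice X]
    [AddCommGroup Y] [Module ℝ Y] [Lattice Y] (T : X →ₗ[ℝ] Y) : Prop where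
  map_sup : ∀ x y, T (x ⊔ y) = T x ⊔ T y
  map_inf : ∀ x y, T (x ⊓ y) = T x ⊓ T y

/-- The vector space of continuous, positively homogeneous functions `ℝ^m → ℝ`. -/
def PosHom (m : ℕ) : Submodule ℝ ((Fin m → ℝ) → ℝ) where
  carrier := {h | Continuous h ∧ ∀ c : ℝ, 0 ≤ c → ∀ t, h (c • t) = c * h t}
  zero_mem' := ⟨continuous_const, by simp⟩
  add_mem' := fun hf hg => ⟨hf.1.add hg.1, fun c hc t => by
    simp only [Pi.add_apply, hf.2 c hc t, hg.2 c hc t, mul_add]⟩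
  smul_mem' := fun a f hf => ⟨hf.1.const_smul a, fun c hc t => by
    simp only [Pi.smul_apply, smul_eq_mul, hf.2 c hc t]; ring⟩

theorem PosHom.sup_mem {m : ℕ} {f g : (Fin m → ℝ) → ℝ} (hf : f ∈ PosHom m) (hg : g ∈ PosHom m) :
    f ⊔ g ∈ PosHom m :=
  ⟨hf.1.sup hg.1, fun c hc t => by
    simp only [Pi.sup_apply, hf.2 c hc t, hg.2 c hc t, mul_max_of_nonneg _ _ hc]⟩

theorem PosHom.inf_mem {m : ℕ} {f g : (Fin m → ℝ) → ℝ} (hf : f ∈ PosHom m) (hg : g ∈ PosHom m) :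
    f ⊓ g ∈ PosHom m :=
  ⟨hf.1.inf hg.1, fun c hc t => by
    simp only [Pi.inf_apply, hf.2 c hc t, hg.2 c hc t, mul_min_of_nonneg _ _ hc]⟩

/-- The pointwise lattice operations on `PosHom m`. -/
instance PosHom.instLattice (m : ℕ) : Lattice (PosHom m) :=
  Subtype.lattice (fun {_ _} hf hg => PosHom.sup_mem hf hg)
    (fun {_ _} hf hg => PosHom.inf_mem hf hg)

/-- The `k`-th coordinate projection. -/
def PosHom.proj {m : ℕ} (k : Fin m) : PosHom m :=
  ⟨fun t => t k, continuous_apply k, fun c _ t => by simp⟩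

/-- `Φ` is the positively homogeneous continuous function calculus at the tuple `x`, so that
`Φ h` is the element `h (x₁, …, x_m)` of `X`. In an Archimedean vector lattice there is at most one
such `Φ`, and in a Banach lattice there is exactly one. -/
structure IsFunctionCalculus {X : Type*} [AddCommGroup X] [Module ℝ X] [Lattice X] {m : ℕ}
    (x : Fin m → X) (Φ : PosHom m →ₗ[ℝ] X) : Prop where
  isLatticeHom : IsLatticeHom Φ
  map_proj : ∀ k, Φ (PosHom.proj k) = x k

/-- `h` is monotone on the positive orthant. -/
def PosHom.IsMonotone {m : ℕ} (h : PosHom m) : Prop :=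
  ∀ t s : Fin m → ℝ, 0 ≤ t → t ≤ s → h.1 t ≤ h.1 s

/-- A convexity condition `(𝒢, M, ϑ)`; an element of `𝒢` is a function together with its number
`m ≥ 1` of variables. -/
structure ConvexityCondition where
  G : Set (Σ m : ℕ+, PosHom m)
  nonempty : G.Nonempty
  monotone : ∀ g ∈ G, PosHom.IsMonotone g.2
  M : G → ℝ
  one_le : ∀ g, 1 ≤ M g
  ϑ : G → Fin 2

/-- Lattice seminorms on a vector lattice. -/
def IsLatticeSeminorm {X : Type*} [AddCommGroup X] [Module ℝ X] [Lattice X]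
    (ν : Seminorm ℝ X) : Prop :=
  ∀ x y : X, |x| ≤ |y| → ν x ≤ ν y

/-- `ν (g (x₁, …, x_m)) ≤ M g * g (ν x₁, …, ν x_m)` for all `g` in `𝒢` and all positive `x_i`,
which are only taken pairwise disjoint if `ϑ g = 0`. -/
def ConvexityCondition.IsConvex (D : ConvexityCondition) {X : Type*} [AddCommGroup X] [Module ℝ X]
    [Lattice X] (ν : Seminorm ℝ X) : Prop :=
  ∀ (g : D.G) (x : Fin g.1.1 → X), (∀ i, 0 ≤ x i) →
    (D.ϑ g = 0 → Pairwise fun i j => x i ⊓ x j = 0) →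
    ∀ Φ : PosHom g.1.1 →ₗ[ℝ] X, IsFunctionCalculus x Φ →
      ν (Φ g.1.2) ≤ D.M g * g.1.2.1 (fun i => ν (x i))

section FreeVectorLattice

variable (E : Type*) [NormedAddCommGroup E] [NormedSpace ℝ E]

/-- The closed unit ball of the dual space. -/
abbrev DualBall : Type _ := Metric.closedBall (0 : StrongDual ℝ E) 1

variable {E} in
/-- The function `h (δ_{x₁}, …, δ_{x_m})` on the dual unit ball, where `δ_x` is evaluation
at `x`. -/
def evalFun {m : ℕ} (h : PosHom m) (x : Fin m → E) : DualBall E → ℝ :=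
  fun f => h.1 fun i => f.1 (x i)

theorem exists_evalFun_comp (k : PosHom 2) {a b : DualBall E → ℝ}
    (ha : ∃ (m : ℕ) (h : PosHom m) (x : Fin m → E), a = evalFun h x)
    (hb : ∃ (m : ℕ) (h : PosHom m) (x : Fin m → E), b = evalFun h x) :
    ∃ (m : ℕ) (h : PosHom m) (x : Fin m → E), (fun f => k.1 ![a f, b f]) = evalFun h x := by
  obtain ⟨m, h, x, rfl⟩ := ha
  obtain ⟨n, l, y, rfl⟩ := hb
  refine ⟨m + n, ⟨fun t => k.1 ![h.1 fun i => t (Fin.castAdd n i), l.1 fun i => t (Fin.natAdd m i)],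
    ?_, fun c hc t => ?_⟩, Fin.append x y, ?_⟩
  · have h1 := h.2.1
    have h2 := l.2.1
    refine k.2.1.comp (continuous_pi fun i => ?_)
    fin_cases i
    · exact h1.comp (by fun_prop)
    · exact h2.comp (by fun_prop)
  · refine Eq.trans (congrArg k.1 ?_) (k.2.2 c hc _)
    funext i
    fin_cases i
    · exact h.2.2 c hc _
    · exact l.2.2 c hc _
  · funext f
    simp [evalFun]

/-- The space `Y₀` of all functions `h (δ_{x₁}, …, δ_{x_m})` on the dual unit ball, with `h`
continuous and positively homogeneous and `x₁, …, x_m` in `E`. -/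
def FreeFun : Submodule ℝ (DualBall E → ℝ) where
  carrier := {a | ∃ (m : ℕ) (h : PosHom m) (x : Fin m → E), a = evalFun h x}
  zero_mem' := ⟨0, 0, ![], rfl⟩
  add_mem' := fun {a b} ha hb => by
    obtain ⟨m, h, x, hx⟩ := exists_evalFun_comp E (PosHom.proj 0 + PosHom.proj 1) ha hb
    exact ⟨m, h, x, hx⟩
  smul_mem' := by
    rintro c _ ⟨m, h, x, rfl⟩
    exact ⟨m, c • h, x, rfl⟩

/-- The pointwise lattice operations on `FreeFun E`. -/
instance FreeFun.instLattice : Lattice (FreeFun E) :=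
  Subtype.lattice
    (fun {_ _} ha hb => exists_evalFun_comp E (PosHom.proj 0 ⊔ PosHom.proj 1) ha hb)
    (fun {_ _} ha hb => exists_evalFun_comp E (PosHom.proj 0 ⊓ PosHom.proj 1) ha hb)

variable {E}

/-- The evaluation `δ_x` as an element of `FreeFun E`. -/
def FreeFun.delta (x : E) : FreeFun E :=
  ⟨fun f => f.1 x, 1, PosHom.proj 0, fun _ => x, rfl⟩

variable (E)

/-- The `D`-convex lattice seminorms `ν` on `FreeFun E` with `ν δ_x ≤ ‖x‖` for all `x`. -/
def freeSeminorms (D : ConvexityCondition) : Set (Seminorm ℝ (FreeFun E)) :=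
  {ν | IsLatticeSeminorm ν ∧ D.IsConvex ν ∧ ∀ x : E, ν (FreeFun.delta x) ≤ ‖x‖}

end FreeVectorLattice

open Filter Topology

/-!
The free `D`-convex Banach lattice `F` is the completion of `FreeFun E` in the norm
`sSup (freeSeminorms E D)`.

* This supremum is finite because every positively homogeneous `h` satisfies
  `|h t| ≤ C * ∑ |t i|` (`PosHom.exists_abs_le`). It is `D`-convex because the functions of a
  convexity condition are monotone on the positive orthant (`isGreatest_sSup_freeSeminorms`).
  Evaluation at a point of the dual ball is a lattice homomorphism to `ℝ`, and `ℝ` is `D`-convex,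
  so `a ↦ |a f|` is one of the seminorms. Hence the supremum is a norm, and by Hahn–Banach it gives
  `δ_x` the norm `‖x‖`.
* The continuous positively homogeneous functions are limits, uniformly relative to the `ℓ¹`-norm,
  of functions in the vector lattice generated by the coordinates
  (`PosHom.exists_mem_abs_sub_le`, from the lattice form of the Stone–Weierstrass theorem). In a
  normed lattice the function calculus is therefore unique and depends continuously on the tuple
  (`IsFunctionCalculus.tendsto`), so `D`-convexity passes from a dense sublattice to its completion
  (`ConvexityCondition.IsConvex.of_denseRange`).
* An operator `T` from `E` to a Banach lattice `X` extends to a lattice homomorphism on `FreeFun E`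
  (`FreeFun.exists_latticeHom`). On the vector lattice generated by the `δ_x`, every element of
  which is a finite supremum of finite infima of `δ_x`'s, it suffices that `⋀ δ_{x_i} ≤ 0` implies
  `⋀ T x_i ≤ 0`. By Hahn–Banach, the first inequality means that `0` is a convex combination of the
  `x_i`; the second one follows, since an infimum is at most any convex combination. The extension
  to all of `FreeFun E` is by relatively uniform approximation. No function calculus on `X` is
  needed for this.
* If `X` is `D`-convex, the norm of `X` pulls back to a `D`-convex lattice seminorm on `FreeFun E`,
  so the extension is bounded by `‖T‖` and passes to the completion. It is unique, since lattice
  homomorphisms on a Banach lattice are continuous (`IsLatticeHom.continuous`) and the function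
  calculus is unique (`FreeFun.hom_ext`).
-/

/-! ### Lattice homomorphisms -/

namespace IsLatticeHom

variable {X Y Z : Type*} [AddCommGroup X] [Module ℝ X] [Lattice X]
  [AddCommGroup Y] [Module ℝ Y] [Lattice Y] [AddCommGroup Z] [Module ℝ Z] [Lattice Z]

theorem comp {S : Y →ₗ[ℝ] Z} {T : X →ₗ[ℝ] Y} (hS : IsLatticeHom S) (hT : IsLatticeHom T) :
    IsLatticeHom (S ∘ₗ T) :=
  ⟨fun x y => by simp [hT.map_sup, hS.map_sup], fun x y => by simp [hT.map_inf, hS.map_inf]⟩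

theorem map_abs {T : X →ₗ[ℝ] Y} (hT : IsLatticeHom T) (x : X) : T |x| = |T x| := by
  simp only [abs, hT.map_sup, map_neg]

theorem mono {T : X →ₗ[ℝ] Y} (hT : IsLatticeHom T) {x y : X} (h : x ≤ y) : T x ≤ T y := by
  rw [← sup_eq_right, ← hT.map_sup, sup_eq_right.2 h]

end IsLatticeHom

theorem abs_sup_sub_sup_le_add {X : Type*} [AddCommGroup X] [Lattice X] [IsOrderedAddMonoid X]
    (a b c d : X) : |a ⊔ b - c ⊔ d| ≤ |a - c| + |b - d| := by
  calc
    |a ⊔ b - c ⊔ d| = |a ⊔ b - c ⊔ b + (c ⊔ b - c ⊔ d)| := by rw [sub_add_sub_cancel]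
    _ ≤ |a ⊔ b - c ⊔ b| + |c ⊔ b - c ⊔ d| := abs_add_le _ _
    _ ≤ |a - c| + |b - d| := by
      gcongr ?_ + ?_
      · exact abs_sup_sub_sup_le_abs _ _ _
      · rw [sup_comm c, sup_comm c]
        exact abs_sup_sub_sup_le_abs _ _ _

theorem abs_inf_sub_inf_le_add {X : Type*} [AddCommGroup X] [Lattice X] [IsOrderedAddMonoid X]
    (a b c d : X) : |a ⊓ b - c ⊓ d| ≤ |a - c| + |b - d| := by
  calc
    |a ⊓ b - c ⊓ d| = |a ⊓ b - c ⊓ b + (c ⊓ b - c ⊓ d)| := by rw [sub_add_sub_cancel]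
    _ ≤ |a ⊓ b - c ⊓ b| + |c ⊓ b - c ⊓ d| := abs_add_le _ _
    _ ≤ |a - c| + |b - d| := by
      gcongr ?_ + ?_
      · exact abs_inf_sub_inf_le_abs _ _ _
      · rw [inf_comm c, inf_comm c]
        exact abs_inf_sub_inf_le_abs _ _ _

theorem smul_sup_of_nonneg {X : Type*} [AddCommGroup X] [Module ℝ X] [Lattice X]
    [IsOrderedModule ℝ X] {c : ℝ} (hc : 0 ≤ c) (x y : X) : c • (x ⊔ y) = c • x ⊔ c • y := by
  rcases hc.eq_or_lt with rfl | hc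
  · simp
  · exact (OrderIso.smulRight hc).map_sup x y

theorem abs_smul_of_nonneg {X : Type*} [AddCommGroup X] [Module ℝ X] [Lattice X]
    [IsOrderedModule ℝ X] {c : ℝ} (hc : 0 ≤ c) (x : X) : |c • x| = c • |x| := by
  rw [abs, abs, smul_sup_of_nonneg hc, smul_neg]

/-! ### Positively homogeneous functions -/

namespace PosHom

variable {m : ℕ}

instance instIsOrderedAddMonoid : IsOrderedAddMonoid (PosHom m) where
  add_le_add_left _ _ h c := fun t => add_le_add_left (h t) (c.1 t)

instance instIsOrderedModule : IsOrderedModule ℝ (PosHom m) where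
  smul_le_smul_of_nonneg_left _ hc _ _ h := fun t => mul_le_mul_of_nonneg_left (h t) hc
  smul_le_smul_of_nonneg_right _ hf _ _ h := fun t => mul_le_mul_of_nonneg_right h (hf t)

/-- Evaluation at `t`, as a linear map. -/
def eval (t : Fin m → ℝ) : PosHom m →ₗ[ℝ] ℝ where
  toFun h := h.1 t
  map_add' _ _ := rfl
  map_smul' _ _ := rfl

theorem isFunctionCalculus_eval (t : Fin m → ℝ) : IsFunctionCalculus t (eval t) :=
  ⟨⟨fun _ _ => rfl, fun _ _ => rfl⟩, fun _ => rfl⟩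

theorem apply_zero (h : PosHom m) : h.1 0 = 0 := by
  simpa using h.2.2 0 le_rfl 0

theorem IsMonotone.nonneg {g : PosHom m} (hg : IsMonotone g) {t : Fin m → ℝ} (ht : 0 ≤ t) :
    0 ≤ g.1 t :=
  (apply_zero g).symm.trans_le (hg 0 t le_rfl ht)

theorem sum_abs_proj_apply (t : Fin m → ℝ) :
    (∑ i, |(proj i : PosHom m)|).1 t = ∑ i, |t i| :=
  (map_sum (eval t) _ _).trans rfl

/-- A positively homogeneous function is dominated by a multiple of the `ℓ¹`-norm. -/
theorem exists_abs_le (h : PosHom m) : ∃ C : ℝ, 0 ≤ C ∧ |h| ≤ C • ∑ i, |(proj i : PosHom m)| := by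
  have hc := h.2.1.continuousAt (x := 0)
  obtain ⟨δ, hδ, H⟩ := Metric.continuousAt_iff.1 hc 1 one_pos
  refine ⟨2 / δ, by positivity, fun t => ?_⟩
  change |h.1 t| ≤ 2 / δ * (∑ i, |(proj i : PosHom m)|).1 t
  rw [sum_abs_proj_apply]
  have hS : ‖t‖ ≤ ∑ i, |t i| := (pi_norm_le_iff_of_nonneg (by positivity)).2 fun i =>
    Finset.single_le_sum (f := fun i => |t i|) (fun i _ => abs_nonneg (t i)) (Finset.mem_univ i)
  rcases eq_or_ne t 0 with rfl | ht
  · simp [apply_zero]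
  have ht' : 0 < ‖t‖ := norm_pos_iff.2 ht
  have h2 := H (x := (δ / (2 * ‖t‖)) • t) (by
    rw [dist_zero_right, norm_smul, Real.norm_of_nonneg (by positivity)]
    field_simp
    linarith)
  rw [h.2.2 _ (by positivity), apply_zero, dist_zero_right, Real.norm_eq_abs, abs_mul,
    abs_of_nonneg (by positivity)] at h2
  have h3 : |h.1 t| ≤ 2 / δ * ‖t‖ := by
    rw [div_mul_eq_mul_div, div_lt_one (by positivity)] at h2
    rw [div_mul_eq_mul_div, le_div_iff₀ hδ]
    linarith
  exact h3.trans (mul_le_mul_of_nonneg_left hS (by positivity))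

/-- **Lattice Stone–Weierstrass theorem** for positively homogeneous functions: the sublattices
that contain the coordinates are uniformly dense relative to the `ℓ¹`-norm. -/
theorem exists_mem_abs_sub_le (L : Submodule ℝ (PosHom m))
    (hL : IsSublattice (L : Set (PosHom m))) (hproj : ∀ k, proj k ∈ L) (h : PosHom m) {ε : ℝ}
    (hε : 0 < ε) : ∃ p ∈ L, |h - p| ≤ ε • ∑ i, |(proj i : PosHom m)| := by
  -- The Euclidean sphere has the advantage that `x - y` separates the rays of `x` and `y`.
  let S : Set (Fin m → ℝ) := {t | ∑ i, t i ^ 2 = 1}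
  have hle : ∀ t ∈ S, ∀ i, |t i| ≤ 1 := fun t ht i => by
    rw [← sq_le_one_iff_abs_le_one, ← show ∑ i, t i ^ 2 = 1 from ht]
    exact Finset.single_le_sum (f := fun i => t i ^ 2) (fun i _ => sq_nonneg _)
      (Finset.mem_univ i)
  have hS : IsCompact S := by
    refine Metric.isCompact_of_isClosed_isBounded
      (isClosed_eq (by fun_prop) continuous_const) ?_
    refine (Metric.isBounded_closedBall (x := 0) (r := 1)).subset fun t ht => ?_
    rw [mem_closedBall_zero_iff]
    exact (pi_norm_le_iff_of_nonneg zero_le_one).2 (hle t ht)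
  have : CompactSpace S := isCompact_iff_compactSpace.1 hS
  let r : PosHom m → C(S, ℝ) := fun p => ⟨fun t => p.1 t, p.2.1.comp continuous_subtype_val⟩
  let lin : (Fin m → ℝ) → PosHom m := fun a => ∑ i, a i • proj i
  have hlin : ∀ a, lin a ∈ L := fun a => L.sum_mem fun i _ => L.smul_mem _ (hproj i)
  have hlin_apply : ∀ a t, (lin a).1 t = ∑ i, a i * t i := fun a t =>
    (map_sum (eval t) (fun i => a i • proj i) Finset.univ).trans rfl
  have hdense := ContinuousMap.sublattice_closure_eq_top (r '' (L : Set (PosHom m)))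
    ⟨_, 0, L.zero_mem, rfl⟩
    (by rintro _ ⟨p, hp, rfl⟩ _ ⟨q, hq, rfl⟩; exact ⟨p ⊓ q, hL.infClosed hp hq, rfl⟩)
    (by rintro _ ⟨p, hp, rfl⟩ _ ⟨q, hq, rfl⟩; exact ⟨p ⊔ q, hL.supClosed hp hq, rfl⟩)
    (by
      have key : ∀ x y : S, x ≠ y → ∃ p ∈ L, p.1 x.1 = 1 ∧ p.1 y.1 = 0 := by
        intro x y hxy
        have hx : ∑ i, x.1 i ^ 2 = 1 := x.2
        have hy : ∑ i, y.1 i ^ 2 = 1 := y.2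
        have hpos : 0 < ∑ i, (x.1 i - y.1 i) ^ 2 := by
          obtain ⟨i, hi⟩ := Function.ne_iff.1 (Subtype.coe_injective.ne hxy)
          exact Finset.sum_pos' (fun i _ => sq_nonneg _)
            ⟨i, Finset.mem_univ i, by have := sub_ne_zero.2 hi; positivity⟩
        have hexp : ∑ i, (x.1 i - y.1 i) ^ 2 = 2 - 2 * ∑ i, x.1 i * y.1 i := by
          simp only [sub_sq, Finset.sum_add_distrib, Finset.sum_sub_distrib, hx, hy,
            mul_assoc, ← Finset.mul_sum]
          ring
        set c := 1 - ∑ i, x.1 i * y.1 i with hc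
        have hc0 : 0 < c := by linarith
        have h1 : (lin (x.1 - y.1)).1 x.1 = c := by
          rw [hlin_apply, hc, ← hx, ← Finset.sum_sub_distrib]
          exact Finset.sum_congr rfl fun i _ => by simp only [Pi.sub_apply]; ring
        have h2 : (lin (x.1 - y.1)).1 y.1 = -c := by
          rw [hlin_apply, hc, ← hy, neg_sub, ← Finset.sum_sub_distrib]
          exact Finset.sum_congr rfl fun i _ => by simp only [Pi.sub_apply]; ring
        refine ⟨c⁻¹ • (lin (x.1 - y.1) ⊔ 0),
          L.smul_mem _ (hL.supClosed (hlin _) L.zero_mem), ?_, ?_⟩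
        · change c⁻¹ * ((lin (x.1 - y.1)).1 x.1 ⊔ 0) = 1
          rw [h1, sup_eq_left.2 hc0.le, inv_mul_cancel₀ hc0.ne']
        · change c⁻¹ * ((lin (x.1 - y.1)).1 y.1 ⊔ 0) = 0
          rw [h2, sup_eq_right.2 (by linarith), mul_zero]
      intro v x y
      rcases eq_or_ne x y with rfl | hxy
      · refine ⟨_, ⟨v x • lin x.1, L.smul_mem _ (hlin _), rfl⟩, ?_⟩
        have h1 : v x * (lin x.1).1 x.1 = v x := by
          rw [hlin_apply, Finset.sum_congr rfl fun i _ => (sq (x.1 i)).symm,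
            show ∑ i, x.1 i ^ 2 = 1 from x.2, mul_one]
        exact ⟨h1, h1⟩
      · obtain ⟨p, hp, hpx, hpy⟩ := key x y hxy
        obtain ⟨q, hq, hqy, hqx⟩ := key y x hxy.symm
        refine ⟨_, ⟨v x • p + v y • q, L.add_mem (L.smul_mem _ hp) (L.smul_mem _ hq), rfl⟩, ?_, ?_⟩
        · change v x * p.1 x.1 + v y * q.1 x.1 = v x
          rw [hpx, hqx]; ring
        · change v x * p.1 y.1 + v y * q.1 y.1 = v y
          rw [hpy, hqy]; ring)
  have hmem : r h ∈ closure (r '' (L : Set (PosHom m))) := hdense ▸ Set.mem_univ _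
  obtain ⟨_, ⟨p, hp, rfl⟩, hd⟩ := Metric.mem_closure_iff.1 hmem ε hε
  refine ⟨p, hp, fun t => ?_⟩
  change |h.1 t - p.1 t| ≤ ε * (∑ i, |(proj i : PosHom m)|).1 t
  rw [sum_abs_proj_apply]
  rcases eq_or_ne t 0 with rfl | ht
  · simp [apply_zero]
  have hsum : 0 < ∑ i, t i ^ 2 := by
    obtain ⟨i, hi⟩ := Function.ne_iff.1 ht
    exact Finset.sum_pos' (fun i _ => sq_nonneg _)
      ⟨i, Finset.mem_univ i, by have : t i ≠ 0 := hi; positivity⟩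
  set ρ := √(∑ i, t i ^ 2) with hρ
  have hρ0 : 0 < ρ := Real.sqrt_pos.2 hsum
  set s : Fin m → ℝ := ρ⁻¹ • t with hs
  have hts : t = ρ • s := by rw [hs, smul_inv_smul₀ hρ0.ne']
  have hsS : s ∈ S := by
    change ∑ i, (ρ⁻¹ * t i) ^ 2 = 1
    simp only [mul_pow, ← Finset.mul_sum]
    rw [inv_pow, hρ, Real.sq_sqrt hsum.le, inv_mul_cancel₀ hsum.ne']
  have h1 : |h.1 s - p.1 s| < ε := (ContinuousMap.dist_apply_le_dist (⟨s, hsS⟩ : S)).trans_lt hd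
  have h2 : 1 ≤ ∑ i, |s i| := by
    rw [← show ∑ i, s i ^ 2 = 1 from hsS]
    refine Finset.sum_le_sum fun i _ => ?_
    rw [← sq_abs]
    nlinarith [abs_nonneg (s i), hle s hsS i]
  rw [hts, h.2.2 _ hρ0.le, p.2.2 _ hρ0.le, ← mul_sub, abs_mul, abs_of_pos hρ0]
  have h3 : ∑ i, |(ρ • s) i| = ρ * ∑ i, |s i| := by
    simp [Finset.mul_sum, abs_mul, abs_of_pos hρ0]
  rw [h3]
  nlinarith [mul_le_mul_of_nonneg_left h2 hε.le]

end PosHom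

/-! ### Function calculus -/

namespace IsFunctionCalculus

theorem comp {X Y : Type*} [AddCommGroup X] [Module ℝ X] [Lattice X] [AddCommGroup Y] [Module ℝ Y]
    [Lattice Y] {m : ℕ} {x : Fin m → X} {Φ : PosHom m →ₗ[ℝ] X} {S : X →ₗ[ℝ] Y}
    (hS : IsLatticeHom S) (hΦ : IsFunctionCalculus x Φ) :
    IsFunctionCalculus (fun i => S (x i)) (S ∘ₗ Φ) :=
  ⟨hS.comp hΦ.isLatticeHom, fun k => congrArg S (hΦ.map_proj k)⟩

theorem map_sum_abs_proj {X : Type*} [AddCommGroup X] [Module ℝ X] [Lattice X] {m : ℕ}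
    {x : Fin m → X} {Φ : PosHom m →ₗ[ℝ] X} (hΦ : IsFunctionCalculus x Φ) :
    Φ (∑ i, |(PosHom.proj i : PosHom m)|) = ∑ i, |x i| := by
  simp [hΦ.isLatticeHom.map_abs, hΦ.map_proj]

variable {X : Type*} [NormedAddCommGroup X] [NormedSpace ℝ X] [Lattice X] [IsOrderedAddMonoid X]
  [HasSolidNorm X] {m : ℕ}

theorem norm_le {x : Fin m → X} {Φ : PosHom m →ₗ[ℝ] X} (hΦ : IsFunctionCalculus x Φ)
    {h : PosHom m} {ε : ℝ} (hε : 0 ≤ ε) (hh : |h| ≤ ε • ∑ i, |(PosHom.proj i : PosHom m)|) :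
    ‖Φ h‖ ≤ ε * ∑ i, ‖x i‖ := by
  have h1 : |Φ h| ≤ ε • ∑ i, |x i| := by
    rw [← hΦ.isLatticeHom.map_abs, ← hΦ.map_sum_abs_proj, ← map_smul]
    exact hΦ.isLatticeHom.mono hh
  calc ‖Φ h‖ ≤ ‖ε • ∑ i, |x i|‖ := norm_le_norm_of_abs_le_abs (h1.trans (le_abs_self _))
    _ ≤ ε * ∑ i, ‖x i‖ := by
      rw [norm_smul, Real.norm_of_nonneg hε]
      refine mul_le_mul_of_nonneg_left ((norm_sum_le _ _).trans_eq ?_) hε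
      simp [norm_abs_eq_norm]

/-- The function calculus depends continuously on the tuple it is taken at. The functions for which
this holds form a sublattice that contains the coordinates, so it is dense. -/
theorem tendsto {ι : Type*} {l : Filter ι} {a : ι → Fin m → X} {b : Fin m → X}
    {Φ : ι → PosHom m →ₗ[ℝ] X} {Ψ : PosHom m →ₗ[ℝ] X} (hΦ : ∀ n, IsFunctionCalculus (a n) (Φ n))
    (hΨ : IsFunctionCalculus b Ψ) (hab : ∀ i, Tendsto (fun n => a n i) l (𝓝 (b i)))
    (g : PosHom m) : Tendsto (fun n => Φ n g) l (𝓝 (Ψ g)) := by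
  let L : Submodule ℝ (PosHom m) :=
    { carrier := {p | Tendsto (fun n => Φ n p) l (𝓝 (Ψ p))}
      zero_mem' := by simpa using tendsto_const_nhds
      add_mem' := fun {p q} hp hq => by simpa using Tendsto.add hp hq
      smul_mem' := fun c p hp => by simpa using Tendsto.const_smul hp c }
  have hL : IsSublattice (L : Set (PosHom m)) := by
    constructor
    · intro p hp q hq
      change Tendsto (fun n => Φ n (p ⊔ q)) l (𝓝 (Ψ (p ⊔ q)))
      simp only [(hΦ _).isLatticeHom.map_sup, hΨ.isLatticeHom.map_sup]
      exact Tendsto.sup_nhds hp hq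
    · intro p hp q hq
      change Tendsto (fun n => Φ n (p ⊓ q)) l (𝓝 (Ψ (p ⊓ q)))
      simp only [(hΦ _).isLatticeHom.map_inf, hΨ.isLatticeHom.map_inf]
      exact Tendsto.inf_nhds hp hq
  have hproj : ∀ k, PosHom.proj k ∈ L := fun k => by
    change Tendsto (fun n => Φ n (PosHom.proj k)) l (𝓝 (Ψ (PosHom.proj k)))
    simpa only [(hΦ _).map_proj, hΨ.map_proj] using hab k
  set C := ∑ i, ‖b i‖ + 1 with hC
  have hC0 : 0 < C := by positivity
  have hev : ∀ᶠ n in l, ∑ i, ‖a n i‖ < C :=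
    (tendsto_finsetSum _ fun i _ => (hab i).norm).eventually_lt_const (lt_add_one _)
  rw [Metric.tendsto_nhds]
  intro ε hε
  obtain ⟨p, hp, hgp⟩ := PosHom.exists_mem_abs_sub_le L hL hproj g
    (show 0 < ε / 3 / C by positivity)
  filter_upwards [hev, Metric.tendsto_nhds.1 hp (ε / 3) (by positivity)] with n hn hn'
  have h1 := (hΦ n).norm_le (by positivity) hgp
  have h2 := hΨ.norm_le (by positivity) hgp
  have h1' : ε / 3 / C * ∑ i, ‖a n i‖ ≤ ε / 3 / C * C := by gcongr
  have h2' : ε / 3 / C * ∑ i, ‖b i‖ < ε / 3 / C * C := by gcongr; linarith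
  rw [div_mul_cancel₀ _ hC0.ne'] at h1' h2'
  rw [dist_eq_norm] at hn' ⊢
  rw [map_sub] at h1 h2
  calc ‖Φ n g - Ψ g‖ = ‖(Φ n g - Φ n p) + (Φ n p - Ψ p) - (Ψ g - Ψ p)‖ := by congr 1; abel
    _ ≤ ‖Φ n g - Φ n p‖ + ‖Φ n p - Ψ p‖ + ‖Ψ g - Ψ p‖ :=
      (norm_sub_le _ _).trans (add_le_add_left (norm_add_le _ _) _)
    _ < ε := by linarith

theorem unique {x : Fin m → X} {Φ Ψ : PosHom m →ₗ[ℝ] X} (hΦ : IsFunctionCalculus x Φ)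
    (hΨ : IsFunctionCalculus x Ψ) : Φ = Ψ :=
  LinearMap.ext fun g => tendsto_nhds_unique (tendsto_const_nhds (x := Φ g) (f := atTop (α := ℕ)))
    (tendsto (fun _ => hΦ) hΨ (fun _ => tendsto_const_nhds) g)

end IsFunctionCalculus

/-! ### Completions of normed lattices -/

namespace UniformSpace.Completion

variable {Y : Type*} [NormedAddCommGroup Y] [Lattice Y] [HasSolidNorm Y] [IsOrderedAddMonoid Y]

theorem uniformContinuous₂_sup : UniformContinuous₂ (fun x y : Y => x ⊔ y) := by
  refine (LipschitzWith.of_dist_le_mul (K := 2) fun p q => ?_).uniformContinuous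
  simp only [Function.uncurry, dist_eq_norm]
  refine (norm_sup_sub_sup_le_add_norm _ _ _ _).trans ?_
  have h1 := norm_fst_le (p - q)
  have h2 := norm_snd_le (p - q)
  simp only [Prod.fst_sub, Prod.snd_sub] at h1 h2
  simp only [NNReal.coe_ofNat]
  linarith

theorem uniformContinuous₂_inf : UniformContinuous₂ (fun x y : Y => x ⊓ y) := by
  refine (LipschitzWith.of_dist_le_mul (K := 2) fun p q => ?_).uniformContinuous
  simp only [Function.uncurry, dist_eq_norm]
  refine (norm_inf_sub_inf_le_add_norm _ _ _ _).trans ?_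
  have h1 := norm_fst_le (p - q)
  have h2 := norm_snd_le (p - q)
  simp only [Prod.fst_sub, Prod.snd_sub] at h1 h2
  simp only [NNReal.coe_ofNat]
  linarith

noncomputable instance instMaxCompletion : Max (Completion Y) := ⟨Completion.map₂ (· ⊔ ·)⟩

noncomputable instance instMinCompletion : Min (Completion Y) := ⟨Completion.map₂ (· ⊓ ·)⟩

theorem coe_sup (x y : Y) : ((x ⊔ y : Y) : Completion Y) = ↑x ⊔ ↑y :=
  (Completion.map₂_coe_coe x y _ uniformContinuous₂_sup).symm

theorem coe_inf (x y : Y) : ((x ⊓ y : Y) : Completion Y) = ↑x ⊓ ↑y :=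
  (Completion.map₂_coe_coe x y _ uniformContinuous₂_inf).symm

instance instContinuousSupCompletion : ContinuousSup (Completion Y) :=
  ⟨Completion.continuous_map₂ continuous_fst continuous_snd⟩

instance instContinuousInfCompletion : ContinuousInf (Completion Y) :=
  ⟨Completion.continuous_map₂ continuous_fst continuous_snd⟩

/-- The lattice operations of a normed lattice, extended to its completion by continuity. -/
noncomputable instance instLatticeCompletion : Lattice (Completion Y) :=
  Lattice.mk'
    (fun a b => induction_on₂ a b (isClosed_eq (by fun_prop) (by fun_prop)) fun x y => by
      rw [← coe_sup, ← coe_sup, sup_comm])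
    (fun a b c => induction_on₃ a b c (isClosed_eq (by fun_prop) (by fun_prop)) fun x y z => by
      simp only [← coe_sup, sup_assoc])
    (fun a b => induction_on₂ a b (isClosed_eq (by fun_prop) (by fun_prop)) fun x y => by
      rw [← coe_inf, ← coe_inf, inf_comm])
    (fun a b c => induction_on₃ a b c (isClosed_eq (by fun_prop) (by fun_prop)) fun x y z => by
      simp only [← coe_inf, inf_assoc])
    (fun a b => induction_on₂ a b (isClosed_eq (by fun_prop) (by fun_prop)) fun x y => by
      rw [← coe_inf, ← coe_sup, sup_inf_self])
    (fun a b => induction_on₂ a b (isClosed_eq (by fun_prop) (by fun_prop)) fun x y => by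
      rw [← coe_sup, ← coe_inf, inf_sup_self])

instance instIsOrderedAddMonoidCompletion : IsOrderedAddMonoid (Completion Y) where
  add_le_add_left a b h c := by
    have key : ∀ a b c : Completion Y, (a + c) ⊔ (b + c) = (a ⊔ b) + c := fun a b c =>
      induction_on₃ a b c (isClosed_eq (by fun_prop) (by fun_prop)) fun x y z => by
        simp only [← coe_sup, ← coe_add, sup_add]
    rw [← sup_eq_right, key, sup_eq_right.2 h]

theorem norm_abs_completion (a : Completion Y) : ‖|a|‖ = ‖a‖ := by
  refine induction_on a (isClosed_eq ?_ (by fun_prop)) fun x => ?_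
  · unfold abs
    fun_prop
  · rw [abs, ← coe_neg, ← coe_sup, norm_coe, norm_coe]
    exact norm_abs_eq_norm x

instance instHasSolidNormCompletion : HasSolidNorm (Completion Y) where
  solid a b h := by
    have key : ∀ a b : Completion Y, ‖|a| ⊓ |b|‖ ≤ ‖b‖ := fun a b => by
      refine induction_on₂ a b (isClosed_le ?_ (by fun_prop)) fun x y => ?_
      · unfold abs
        fun_prop
      · simp only [abs, ← coe_neg, ← coe_sup, ← coe_inf, norm_coe]
        refine norm_le_norm_of_abs_le_abs ?_
        change |(|x| ⊓ |y|)| ≤ |y|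
        rw [abs_of_nonneg (le_inf (abs_nonneg x) (abs_nonneg y))]
        exact inf_le_right
    calc ‖a‖ = ‖|a| ⊓ |b|‖ := by rw [inf_eq_left.2 h, norm_abs_completion]
      _ ≤ ‖b‖ := key a b

variable [NormedSpace ℝ Y] [IsOrderedModule ℝ Y]

instance instIsOrderedModuleCompletion : IsOrderedModule ℝ (Completion Y) where
  smul_le_smul_of_nonneg_left c hc a b h := by
    have key : ∀ a b : Completion Y, c • a ⊔ c • b = c • (a ⊔ b) := fun a b =>
      induction_on₂ a b (isClosed_eq
        ((continuous_fst.const_smul c).sup (continuous_snd.const_smul c))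
        ((continuous_fst.sup continuous_snd).const_smul c)) fun x y => by
        simp only [← coe_sup, ← coe_smul, smul_sup_of_nonneg hc]
    rw [← sup_eq_right, key, sup_eq_right.2 h]
  smul_le_smul_of_nonneg_right a ha c d h := by
    have key : ∀ (e : ℝ), 0 ≤ e → ∀ a : Completion Y, 0 ≤ e • (a ⊔ 0) := fun e he a => by
      rw [← sup_eq_right]
      have h1 : Continuous fun a : Completion Y => e • (a ⊔ 0) :=
        (continuous_id.sup continuous_const).const_smul e
      refine induction_on a (isClosed_eq (continuous_const.sup h1) h1) fun x => ?_
      rw [← coe_zero, ← coe_sup, ← coe_smul, ← coe_sup,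
        sup_eq_right.2 (smul_nonneg he le_sup_right)]
    have h1 := key (d - c) (sub_nonneg.2 h) a
    rwa [sup_eq_left.2 ha, sub_smul, sub_nonneg] at h1

instance instBanachLatticeCompletion : BanachLattice (Completion Y) where

end UniformSpace.Completion

/-- The completion of a vector lattice in a lattice norm is a Banach lattice. -/
theorem exists_banachLattice_completion {Y : Type u} [AddCommGroup Y] [Module ℝ Y] [Lattice Y]
    [IsOrderedAddMonoid Y] [IsOrderedModule ℝ Y] (ν : Seminorm ℝ Y) (hν : IsLatticeSeminorm ν)
    (hν0 : ∀ y, ν y = 0 → y = 0) :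
    ∃ (F : Type u) (_ : NormedAddCommGroup F) (_ : NormedSpace ℝ F) (_ : Lattice F)
      (_ : BanachLattice F) (ι : Y →ₗ[ℝ] F), IsLatticeHom ι ∧ DenseRange ι ∧ ∀ y, ‖ι y‖ = ν y := by
  let N : NormedAddCommGroup Y := AddGroupNorm.toNormedAddCommGroup
    { ν.toAddGroupSeminorm with eq_zero_of_map_eq_zero' := hν0 }
  let M : NormedSpace ℝ Y := { norm_smul_le := fun c y => (map_smul_eq_mul ν c y).le }
  have : HasSolidNorm Y := ⟨hν⟩
  exact ⟨UniformSpace.Completion Y, inferInstance, inferInstance, inferInstance, inferInstance,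
    UniformSpace.Completion.toComplₗᵢ.toLinearMap,
    ⟨UniformSpace.Completion.coe_sup, UniformSpace.Completion.coe_inf⟩,
    UniformSpace.Completion.denseRange_coe, UniformSpace.Completion.norm_coe⟩

/-! ### Disjointification -/

theorem inf_eq_zero_of_le {X : Type*} [Lattice X] [Zero X] {a b c d : X} (ha : 0 ≤ a) (hb : 0 ≤ b)
    (hac : a ≤ c) (hbd : b ≤ d) (h : c ⊓ d = 0) : a ⊓ b = 0 :=
  le_antisymm ((inf_le_inf hac hbd).trans_eq h) (le_inf ha hb)

/-- Disjointification of a tuple: the element `x i` is replaced by the positive part of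
`x i - ∑ j ≠ i, x j`. -/
def disjointify {X : Type*} [AddCommGroup X] [Lattice X] {m : ℕ} (x : Fin m → X) (i : Fin m) : X :=
  (x i - ∑ j ∈ Finset.univ.erase i, x j) ⊔ 0

section disjointify

variable {X : Type*} [AddCommGroup X] [Lattice X] [IsOrderedAddMonoid X] {m : ℕ} {x : Fin m → X}

theorem disjointify_inf (hx : ∀ i, 0 ≤ x i) :
    Pairwise fun i j => disjointify x i ⊓ disjointify x j = 0 := by
  have key : ∀ i j, i ≠ j → disjointify x i ≤ (x i - x j)⁺ := fun i j hij =>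
    sup_le_sup_right (sub_le_sub_left (Finset.single_le_sum (f := x) (fun k _ => hx k)
      (Finset.mem_erase.2 ⟨hij.symm, Finset.mem_univ _⟩)) _) 0
  intro i j hij
  refine inf_eq_zero_of_le le_sup_right le_sup_right (key i j hij) (key j i hij.symm) ?_
  rw [← neg_sub (x i) (x j), posPart_neg]
  exact posPart_inf_negPart_eq_zero _

theorem inf_sum_eq_zero {ι : Type*} (s : Finset ι) {a : X} {y : ι → X} (ha : 0 ≤ a)
    (hy : ∀ i, 0 ≤ y i) (h : ∀ i ∈ s, a ⊓ y i = 0) : a ⊓ ∑ i ∈ s, y i = 0 := by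
  classical
  induction s using Finset.induction_on with
  | empty => simpa using ha
  | insert i s hi ih =>
    rw [Finset.sum_insert hi]
    have h1 := ih fun j hj => h j (Finset.mem_insert_of_mem hj)
    have h2 := h i (Finset.mem_insert_self i s)
    have hs : 0 ≤ ∑ i ∈ s, y i := Finset.sum_nonneg fun i _ => hy i
    refine le_antisymm (h2 ▸ le_inf inf_le_left ?_) (le_inf ha (add_nonneg (hy i) hs))
    calc a ⊓ (y i + ∑ j ∈ s, y j) ≤ (y i + a) ⊓ (y i + ∑ j ∈ s, y j) :=
          inf_le_inf_right _ (le_add_of_nonneg_left (hy i))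
      _ = y i := by rw [← add_inf, h1, add_zero]

theorem disjointify_eq (hx : ∀ i, 0 ≤ x i) (hdisj : Pairwise fun i j => x i ⊓ x j = 0) :
    disjointify x = x := by
  funext i
  have h := inf_sum_eq_zero (Finset.univ.erase i) (hx i) hx fun j hj =>
    hdisj (Finset.ne_of_mem_erase hj).symm
  have h' : x i - (∑ j ∈ Finset.univ.erase i, x j) ⊓ x i = disjointify x i := by
    rw [sub_inf, sub_self, disjointify]
  rw [← h', inf_comm, h, sub_zero]

end disjointify

theorem map_disjointify {X Y : Type*} [AddCommGroup X] [Module ℝ X] [Lattice X] [AddCommGroup Y]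
    [Module ℝ Y] [Lattice Y] {S : X →ₗ[ℝ] Y} (hS : IsLatticeHom S) {m : ℕ} (x : Fin m → X)
    (i : Fin m) : S (disjointify x i) = disjointify (fun j => S (x j)) i := by
  simp [disjointify, hS.map_sup]

/-! ### Convexity -/

namespace ConvexityCondition

variable (D : ConvexityCondition)

/-- `D`-convexity pulls back along lattice homomorphisms. -/
theorem IsConvex.comp {D : ConvexityCondition} {X Y : Type*} [AddCommGroup X] [Module ℝ X]
    [Lattice X] [AddCommGroup Y] [Module ℝ Y] [Lattice Y] {ν : Seminorm ℝ Y} (hν : D.IsConvex ν)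
    {S : X →ₗ[ℝ] Y} (hS : IsLatticeHom S) : D.IsConvex (ν.comp S) := by
  intro g x hx hdisj Φ hΦ
  refine hν g (fun i => S (x i)) (fun i => ?_) (fun h i j hij => ?_) (S ∘ₗ Φ) (hΦ.comp hS)
  · simpa using hS.mono (hx i)
  · change S (x i) ⊓ S (x j) = 0
    rw [← hS.map_inf, show x i ⊓ x j = 0 from hdisj h hij, map_zero]

theorem IsConvex.smul {D : ConvexityCondition} {X : Type*} [AddCommGroup X] [Module ℝ X]
    [Lattice X] {ν : Seminorm ℝ X} (hν : D.IsConvex ν) {c : NNReal} : D.IsConvex (c • ν) := by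
  intro g x hx hdisj Φ hΦ
  have h1 : g.1.2.1 (fun i => (c • ν) (x i)) = c * g.1.2.1 (fun i => ν (x i)) :=
    g.1.2.2.2 c c.2 _
  rw [h1, mul_left_comm]
  exact mul_le_mul_of_nonneg_left (hν g x hx hdisj Φ hΦ) c.2

/-- The real line is `D`-convex, for any convexity condition `D`. -/
theorem isConvex_real : D.IsConvex (normSeminorm ℝ ℝ) := by
  intro g x hx _ Φ hΦ
  have hmono := D.monotone g g.2
  rw [hΦ.unique (PosHom.isFunctionCalculus_eval x)]
  have hg0 : 0 ≤ g.1.2.1 x := hmono.nonneg hx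
  change |g.1.2.1 x| ≤ D.M g * g.1.2.1 fun i => |x i|
  rw [abs_of_nonneg hg0, funext fun i => abs_of_nonneg (hx i)]
  exact le_mul_of_one_le_left hg0 (D.one_le g)

/-- Convexity of a norm on a dense sublattice passes to the whole space. Positive tuples are
approximated by positive tuples, and disjoint positive tuples by disjointifications of positive
tuples. -/
theorem IsConvex.of_denseRange {D : ConvexityCondition} {Y F : Type*} [AddCommGroup Y]
    [Module ℝ Y] [Lattice Y] [IsOrderedAddMonoid Y] [NormedAddCommGroup F] [NormedSpace ℝ F]
    [Lattice F] [IsOrderedAddMonoid F] [HasSolidNorm F] {ι : Y →ₗ[ℝ] F} (hι : IsLatticeHom ι)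
    (hd : DenseRange ι)
    (hcalc : ∀ (m : ℕ) (y : Fin m → Y), ∃ Φ : PosHom m →ₗ[ℝ] Y, IsFunctionCalculus y Φ)
    (h : D.IsConvex ((normSeminorm ℝ F).comp ι)) : D.IsConvex (normSeminorm ℝ F) := by
  intro g x hx hdisj Φ hΦ
  have hy : ∀ i, ∃ y : ℕ → Y, Tendsto (fun n => ι (y n)) atTop (𝓝 (x i)) := fun i => by
    obtain ⟨u, hu, hlim⟩ := mem_closure_iff_seq_limit.1 (hd (x i))
    choose y hy using hu
    exact ⟨y, by simpa only [hy] using hlim⟩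
  choose y hy using hy
  have hpos : ∀ i, Tendsto (fun n => ι (y i n ⊔ 0)) atTop (𝓝 (x i)) := fun i => by
    simpa only [hι.map_sup, map_zero, sup_eq_left.2 (hx i)] using
      (hy i).sup_nhds (tendsto_const_nhds (x := (0 : F)))
  obtain ⟨z, hz0, hzdisj, hz⟩ : ∃ z : ℕ → Fin g.1.1 → Y, (∀ n i, 0 ≤ z n i) ∧
      (D.ϑ g = 0 → ∀ n, Pairwise fun i j => z n i ⊓ z n j = 0) ∧
      ∀ i, Tendsto (fun n => ι (z n i)) atTop (𝓝 (x i)) := by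
    by_cases hϑ : D.ϑ g = 0
    · refine ⟨fun n => disjointify fun i => y i n ⊔ 0, fun n i => le_sup_right,
        fun _ n => disjointify_inf fun i => le_sup_right, fun i => ?_⟩
      rw [← disjointify_eq hx (hdisj hϑ)]
      simp only [map_disjointify hι]
      exact ((hpos i).sub (tendsto_finsetSum _ fun j _ => hpos j)).sup_nhds tendsto_const_nhds
    · exact ⟨fun n i => y i n ⊔ 0, fun n i => le_sup_right, fun h => absurd h hϑ, hpos⟩
  choose Ψ hΨ using fun n => hcalc _ (z n)
  have hlim := IsFunctionCalculus.tendsto (fun n => (hΨ n).comp hι) hΦ hz g.1.2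
  refine le_of_tendsto_of_tendsto' hlim.norm ?_
    fun n => h g (z n) (hz0 n) (fun hϑ => hzdisj hϑ n) (Ψ n) (hΨ n)
  exact ((g.1.2.2.1.tendsto _).comp (tendsto_pi_nhds.2 fun i => (hz i).norm)).const_mul _

end ConvexityCondition

/-! ### The vector lattice of functions on the dual ball -/

namespace FreeFun

variable {E : Type*} [NormedAddCommGroup E] [NormedSpace ℝ E]

instance instIsOrderedAddMonoid : IsOrderedAddMonoid (FreeFun E) where
  add_le_add_left _ _ h c := fun t => add_le_add_left (h t) (c.1 t)

instance instIsOrderedModule : IsOrderedModule ℝ (FreeFun E) where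
  smul_le_smul_of_nonneg_left _ hc _ _ h := fun t => mul_le_mul_of_nonneg_left (h t) hc
  smul_le_smul_of_nonneg_right _ hf _ _ h := fun t => mul_le_mul_of_nonneg_right h (hf t)

/-- `δ`, as a linear map. -/
def deltaₗ : E →ₗ[ℝ] FreeFun E where
  toFun := delta
  map_add' x y := Subtype.ext (funext fun f => map_add f.1 x y)
  map_smul' c x := Subtype.ext (funext fun f => map_smul f.1 c x)

/-- Evaluation at a point of the dual ball. -/
def evalAt (f : DualBall E) : FreeFun E →ₗ[ℝ] ℝ where
  toFun a := a.1 f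
  map_add' _ _ := rfl
  map_smul' _ _ := rfl

theorem isLatticeHom_evalAt (f : DualBall E) : IsLatticeHom (evalAt f) :=
  ⟨fun _ _ => rfl, fun _ _ => rfl⟩

theorem comp_mem {m : ℕ} (h : PosHom m) (y : Fin m → FreeFun E) :
    (fun f => h.1 fun i => (y i).1 f) ∈ FreeFun E := by
  choose n k x hx using fun i => (y i).2
  refine ⟨∑ i, n i, ⟨fun t => h.1 fun i => (k i).1 fun j => t (finSigmaFinEquiv ⟨i, j⟩), ?_,
    fun c hc t => ?_⟩, fun j => x (finSigmaFinEquiv.symm j).1 (finSigmaFinEquiv.symm j).2, ?_⟩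
  · exact h.2.1.comp (continuous_pi fun i => (k i).2.1.comp (by fun_prop))
  · exact (congrArg h.1 (funext fun i => (k i).2.2 c hc _)).trans (h.2.2 c hc _)
  · funext f
    simp only [hx, evalFun]
    refine congrArg h.1 (funext fun i => congrArg (k i).1 (funext fun j => ?_))
    rw [Equiv.symm_apply_apply]

/-- The function calculus of `FreeFun E`, which is computed pointwise. -/
def calculus {m : ℕ} (y : Fin m → FreeFun E) : PosHom m →ₗ[ℝ] FreeFun E where
  toFun h := ⟨fun f => h.1 fun i => (y i).1 f, comp_mem h y⟩
  map_add' _ _ := rfl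
  map_smul' _ _ := rfl

theorem isFunctionCalculus_calculus {m : ℕ} (y : Fin m → FreeFun E) :
    IsFunctionCalculus y (calculus y) :=
  ⟨⟨fun _ _ => rfl, fun _ _ => rfl⟩, fun _ => rfl⟩

theorem exists_eq_calculus (a : FreeFun E) :
    ∃ (m : ℕ) (h : PosHom m) (x : Fin m → E), a = calculus (fun i => delta (x i)) h := by
  obtain ⟨m, h, x, hx⟩ := a.2
  exact ⟨m, h, x, Subtype.ext hx⟩

/-- Two lattice homomorphisms into a normed lattice that agree on the evaluations are equal. -/
theorem hom_ext {X : Type*} [NormedAddCommGroup X] [NormedSpace ℝ X] [Lattice X]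
    [IsOrderedAddMonoid X] [HasSolidNorm X] {S T : FreeFun E →ₗ[ℝ] X} (hS : IsLatticeHom S)
    (hT : IsLatticeHom T) (h : ∀ x, S (delta x) = T (delta x)) : S = T := by
  refine LinearMap.ext fun a => ?_
  obtain ⟨m, k, x, rfl⟩ := exists_eq_calculus a
  have h1 := (isFunctionCalculus_calculus fun i => delta (x i)).comp hS
  have h2 := (isFunctionCalculus_calculus fun i => delta (x i)).comp hT
  simp only [h] at h1
  exact LinearMap.congr_fun (h1.unique h2) k

end FreeFun

/-! ### The vector sublattice generated by a subspace -/

section LatticeClosure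

variable {R : Type*} [AddCommGroup R] [Module ℝ R] [Lattice R]

theorem IsSublattice.abs_mem {L : Submodule ℝ R} (hL : IsSublattice (L : Set R)) {a : R}
    (ha : a ∈ L) : |a| ∈ L :=
  hL.supClosed ha (L.neg_mem ha)

variable [IsOrderedAddMonoid R] [IsOrderedModule ℝ R]

instance Prod.instIsOrderedModule {X Y : Type*} [AddCommGroup X] [PartialOrder X] [Module ℝ X]
    [IsOrderedModule ℝ X] [AddCommGroup Y] [PartialOrder Y] [Module ℝ Y] [IsOrderedModule ℝ Y] :
    IsOrderedModule ℝ (X × Y) where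
  smul_le_smul_of_nonneg_left _ hc _ _ h :=
    ⟨smul_le_smul_of_nonneg_left h.1 hc, smul_le_smul_of_nonneg_left h.2 hc⟩
  smul_le_smul_of_nonneg_right _ hf _ _ h :=
    ⟨smul_le_smul_of_nonneg_right h hf.1, smul_le_smul_of_nonneg_right h hf.2⟩

theorem smul_inf_of_nonneg {c : ℝ} (hc : 0 ≤ c) (x y : R) : c • (x ⊓ y) = c • x ⊓ c • y := by
  rw [← neg_neg (x ⊓ y), neg_inf, smul_neg, smul_sup_of_nonneg hc, neg_sup, smul_neg, smul_neg,
    neg_neg, neg_neg]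

/-- The sublattice generated by a subspace is a subspace. -/
def Submodule.vectorSublattice (V : Submodule ℝ R) : Submodule ℝ R where
  carrier := latticeClosure (V : Set R)
  zero_mem' := subset_latticeClosure V.zero_mem
  add_mem' := by
    have hL := isSublattice_latticeClosure (s := (V : Set R))
    have h1 : ∀ a ∈ latticeClosure (V : Set R), ∀ v ∈ V, a + v ∈ latticeClosure (V : Set R) := by
      intro a ha v hv
      refine latticeClosure_min (t := {a | a + v ∈ latticeClosure (V : Set R)})
        (fun w hw => subset_latticeClosure (V.add_mem hw hv)) ⟨?_, ?_⟩ ha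
      · intro b hb c hc
        change b ⊔ c + v ∈ latticeClosure (V : Set R)
        rw [sup_add]
        exact hL.supClosed hb hc
      · intro b hb c hc
        change b ⊓ c + v ∈ latticeClosure (V : Set R)
        rw [inf_add]
        exact hL.infClosed hb hc
    intro a b ha hb
    refine latticeClosure_min (t := {b | a + b ∈ latticeClosure (V : Set R)})
      (fun w hw => h1 a ha w hw) ⟨?_, ?_⟩ hb
    · intro b hb c hc
      change a + b ⊔ c ∈ latticeClosure (V : Set R)
      rw [add_sup]
      exact hL.supClosed hb hc
    · intro b hb c hc
      change a + b ⊓ c ∈ latticeClosure (V : Set R)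
      rw [add_inf]
      exact hL.infClosed hb hc
  smul_mem' := by
    have hL := isSublattice_latticeClosure (s := (V : Set R))
    have h1 : ∀ a ∈ latticeClosure (V : Set R), -a ∈ latticeClosure (V : Set R) := by
      intro a ha
      refine latticeClosure_min (t := {a | -a ∈ latticeClosure (V : Set R)})
        (fun w hw => subset_latticeClosure (V.neg_mem hw)) ⟨?_, ?_⟩ ha
      · intro b hb c hc
        change -(b ⊔ c) ∈ latticeClosure (V : Set R)
        rw [_root_.neg_sup]
        exact hL.infClosed hb hc
      · intro b hb c hc
        change -(b ⊓ c) ∈ latticeClosure (V : Set R)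
        rw [_root_.neg_inf]
        exact hL.supClosed hb hc
    have h2 : ∀ c : ℝ, 0 ≤ c → ∀ a ∈ latticeClosure (V : Set R),
        c • a ∈ latticeClosure (V : Set R) := by
      intro c hc a ha
      refine latticeClosure_min (t := {a | c • a ∈ latticeClosure (V : Set R)})
        (fun w hw => subset_latticeClosure (V.smul_mem c hw)) ⟨?_, ?_⟩ ha
      · intro x hx y hy
        change c • (x ⊔ y) ∈ latticeClosure (V : Set R)
        rw [smul_sup_of_nonneg hc]
        exact hL.supClosed hx hy
      · intro x hx y hy
        change c • (x ⊓ y) ∈ latticeClosure (V : Set R)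
        rw [smul_inf_of_nonneg hc]
        exact hL.infClosed hx hy
    intro c a ha
    rcases le_total 0 c with hc | hc
    · exact h2 c hc a ha
    · simpa using h1 _ (h2 (-c) (neg_nonneg.2 hc) a ha)

theorem Submodule.isSublattice_vectorSublattice (V : Submodule ℝ R) :
    IsSublattice (V.vectorSublattice : Set R) :=
  isSublattice_latticeClosure

theorem Submodule.le_vectorSublattice (V : Submodule ℝ R) : V ≤ V.vectorSublattice :=
  subset_latticeClosure

/-- The elements of the sublattice generated by a subspace are finite suprema of finite infima of
elements of the subspace. -/
theorem Submodule.vectorSublattice_subset {V : Submodule ℝ R} {s : Set R} (hs : SupClosed s)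
    (h : ∀ t : Finset R, ∀ ht : t.Nonempty, (t : Set R) ⊆ V → t.inf' ht id ∈ s) :
    (V.vectorSublattice : Set R) ⊆ s := by
  let _ : DistribLattice R := AddCommGroup.toDistribLattice R
  change latticeClosure (V : Set R) ⊆ s
  rw [← supClosure_infClosure]
  refine supClosure_min ?_ hs
  rintro _ ⟨t, ht, htV, rfl⟩
  exact h t ht htV

/-- The relatively uniform closure of a vector sublattice `L`: all `w` such that for some `e` in
`L` there are elements `p` of `L` with `|w - p| ≤ ε e`, for every `ε > 0`. -/
def Submodule.uniformClosure (L : Submodule ℝ R) (hL : IsSublattice (L : Set R)) :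
    Submodule ℝ R where
  carrier := {w | ∃ e ∈ L, ∀ ε : ℝ, 0 < ε → ∃ p ∈ L, |w - p| ≤ ε • e}
  zero_mem' := ⟨0, L.zero_mem, fun ε _ => ⟨0, L.zero_mem, by simp⟩⟩
  add_mem' := by
    rintro a b ⟨e, he, ha⟩ ⟨e', he', hb⟩
    refine ⟨e + e', L.add_mem he he', fun ε hε => ?_⟩
    obtain ⟨p, hp, hpa⟩ := ha ε hε
    obtain ⟨q, hq, hqb⟩ := hb ε hε
    refine ⟨p + q, L.add_mem hp hq, ?_⟩
    rw [add_sub_add_comm, smul_add]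
    exact (abs_add_le _ _).trans (add_le_add hpa hqb)
  smul_mem' := by
    rintro c a ⟨e, he, ha⟩
    refine ⟨|c| • |e|, L.smul_mem _ (hL.abs_mem he), fun ε hε => ?_⟩
    obtain ⟨p, hp, hpa⟩ := ha ε hε
    refine ⟨c • p, L.smul_mem _ hp, ?_⟩
    have h1 : |c • (a - p)| = |c| • |a - p| := by
      rcases le_total 0 c with hc | hc
      · rw [abs_smul_of_nonneg hc, abs_of_nonneg hc]
      · rw [abs_of_nonpos hc, ← abs_smul_of_nonneg (neg_nonneg.2 hc), neg_smul, abs_neg]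
    rw [← smul_sub, h1, smul_comm ε]
    exact smul_le_smul_of_nonneg_left
      (hpa.trans (smul_le_smul_of_nonneg_left (le_abs_self e) hε.le)) (abs_nonneg c)

theorem Submodule.isSublattice_uniformClosure (L : Submodule ℝ R)
    (hL : IsSublattice (L : Set R)) : IsSublattice (L.uniformClosure hL : Set R) := by
  constructor
  · rintro a ⟨e, he, ha⟩ b ⟨e', he', hb⟩
    refine ⟨e + e', L.add_mem he he', fun ε hε => ?_⟩
    obtain ⟨p, hp, hpa⟩ := ha ε hε
    obtain ⟨q, hq, hqb⟩ := hb ε hε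
    refine ⟨p ⊔ q, hL.supClosed hp hq, ?_⟩
    rw [smul_add]
    exact (abs_sup_sub_sup_le_add _ _ _ _).trans (add_le_add hpa hqb)
  · rintro a ⟨e, he, ha⟩ b ⟨e', he', hb⟩
    refine ⟨e + e', L.add_mem he he', fun ε hε => ?_⟩
    obtain ⟨p, hp, hpa⟩ := ha ε hε
    obtain ⟨q, hq, hqb⟩ := hb ε hε
    refine ⟨p ⊓ q, hL.infClosed hp hq, ?_⟩
    rw [smul_add]
    exact (abs_inf_sub_inf_le_add _ _ _ _).trans (add_le_add hpa hqb)

theorem Submodule.le_uniformClosure (L : Submodule ℝ R) (hL : IsSublattice (L : Set R)) :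
    L ≤ L.uniformClosure hL :=
  fun a ha => ⟨0, L.zero_mem, fun ε _ => ⟨a, ha, by simp⟩⟩

end LatticeClosure

/-! ### Extension of operators to lattice homomorphisms -/

namespace FreeFun

variable {E : Type*} [NormedAddCommGroup E] [NormedSpace ℝ E]

/-- If the minimum of finitely many evaluations is nowhere positive on the dual ball, then `0` is a
convex combination of the evaluation points, by the Hahn–Banach theorem. -/
theorem zero_mem_convexHull {s : Set E} (hs : s.Finite)
    (h : ∀ f : DualBall E, ∃ x ∈ s, f.1 x ≤ 0) : (0 : E) ∈ convexHull ℝ s := by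
  by_contra h0
  obtain ⟨f, c, hc, hf⟩ :=
    geometric_hahn_banach_point_closed (convex_convexHull ℝ s) (hs.isClosed_convexHull ℝ) h0
  rw [map_zero] at hc
  have hpos : ∀ x ∈ s, 0 < f x := fun x hx => hc.trans (hf x (subset_convexHull ℝ s hx))
  obtain ⟨x, hx, hle⟩ := h ⟨(1 + ‖f‖)⁻¹ • f, by
    rw [mem_closedBall_zero_iff, norm_smul, norm_inv, Real.norm_of_nonneg (by positivity),
      inv_mul_le_iff₀ (by positivity)]
    linarith⟩
  have : 0 < (1 + ‖f‖)⁻¹ * f x := mul_pos (by positivity) (hpos x hx)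
  exact this.not_ge hle

variable {X : Type*} [AddCommGroup X] [Module ℝ X] [Lattice X] [IsOrderedAddMonoid X]
  [IsOrderedModule ℝ X]

/-- The graph of a linear map `T` on the space of evaluations. -/
def deltaGraph (T : E →ₗ[ℝ] X) : Submodule ℝ (FreeFun E × X) :=
  LinearMap.range (deltaₗ.prod T)

/-- The assignment `δ_x ↦ T x` induces a positive map on the vector lattice generated by the
evaluations: an inequality `⋀ δ_{x_i} ≤ 0` yields a convex combination `∑ c_i x_i = 0`, and
`⋀ T x_i ≤ ∑ c_i T x_i`. -/
theorem snd_nonpos_of_fst_nonpos (T : E →ₗ[ℝ] X) {w : FreeFun E × X}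
    (hw : w ∈ (deltaGraph T).vectorSublattice) (h : w.1 ≤ 0) : w.2 ≤ 0 := by
  have key : ((deltaGraph T).vectorSublattice : Set (FreeFun E × X)) ⊆
      {w | w.1 ≤ 0 → w.2 ≤ 0} := by
    apply Submodule.vectorSublattice_subset
    · intro a (ha : a.1 ≤ 0 → a.2 ≤ 0) b (hb : b.1 ≤ 0 → b.2 ≤ 0) (hab : a.1 ⊔ b.1 ≤ 0)
      exact (sup_le (ha (le_sup_left.trans hab)) (hb (le_sup_right.trans hab)) :
        a.2 ⊔ b.2 ≤ 0)
    · classical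
      intro t ht htV hle
      have hrange : ∀ w ∈ t, ∃ x, deltaₗ.prod T x = w := fun w hw => htV hw
      choose! c hc using hrange
      have hst : ∀ x ∈ t.image c, (delta x, T x) ∈ t := fun x hx => by
        obtain ⟨w, hw, rfl⟩ := Finset.mem_image.1 hx
        have h1 : (delta (c w), T (c w)) = w := hc w hw
        rwa [h1]
      have h0 : (0 : E) ∈ convexHull ℝ (t.image c : Set E) := by
        refine zero_mem_convexHull (Finset.finite_toSet _) fun f => ?_
        by_contra! hcon
        have hpos : 0 < (t.inf' ht id).1.1 f :=
          Finset.inf'_induction ht id (p := fun w : FreeFun E × X => 0 < w.1.1 f)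
            (fun _ ha _ hb => lt_min ha hb) fun w hw => by
              change 0 < w.1.1 f
              rw [← hc w hw]
              exact hcon (c w) (Finset.mem_coe.2 (Finset.mem_image_of_mem c hw))
        exact hpos.not_ge (hle f)
      -- An infimum is at most any convex combination, and this one is mapped to `T 0`.
      obtain ⟨a, ha0, ha1, ha⟩ := Finset.mem_convexHull'.1 h0
      calc (t.inf' ht id).2 = ∑ x ∈ t.image c, a x • (t.inf' ht id).2 := by
            rw [← Finset.sum_smul, ha1, one_smul]
        _ ≤ ∑ x ∈ t.image c, a x • T x := Finset.sum_le_sum fun x hx =>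
            smul_le_smul_of_nonneg_left (Finset.inf'_le id (hst x hx)).2 (ha0 x hx)
        _ = 0 := by simp only [← map_smul, ← map_sum, ha, map_zero]
  exact key hw h

theorem abs_snd_le_of_abs_fst_le (T : E →ₗ[ℝ] X) {w e : FreeFun E × X}
    (hw : w ∈ (deltaGraph T).vectorSublattice) (he : e ∈ (deltaGraph T).vectorSublattice)
    (h : |w.1| ≤ e.1) : |w.2| ≤ e.2 :=
  sub_nonpos.1 (snd_nonpos_of_fst_nonpos T (w := |w| - e) (Submodule.sub_mem _
    ((Submodule.isSublattice_vectorSublattice _).abs_mem hw) he) (sub_nonpos.2 h))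

/-- The relatively uniform closure of the vector lattice generated by the graph of `δ_x ↦ T x`. -/
def closedGraph (T : E →ₗ[ℝ] X) : Submodule ℝ (FreeFun E × X) :=
  (deltaGraph T).vectorSublattice.uniformClosure (Submodule.isSublattice_vectorSublattice _)

theorem isSublattice_closedGraph (T : E →ₗ[ℝ] X) :
    IsSublattice (closedGraph T : Set (FreeFun E × X)) :=
  Submodule.isSublattice_uniformClosure _ _

theorem delta_mem_closedGraph (T : E →ₗ[ℝ] X) (x : E) : (delta x, T x) ∈ closedGraph T :=
  Submodule.le_uniformClosure _ _ (Submodule.le_vectorSublattice _ ⟨x, rfl⟩)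

variable {X : Type*} [NormedAddCommGroup X] [NormedSpace ℝ X] [Lattice X] [BanachLattice X]

theorem eq_zero_of_mem_closedGraph (T : E →ₗ[ℝ] X) {z : X} (hz : (0, z) ∈ closedGraph T) :
    z = 0 := by
  obtain ⟨e, he, H⟩ := hz
  have key : ∀ ε : ℝ, 0 < ε → ‖z‖ ≤ ε * ‖e.2 + e.2‖ := fun ε hε => by
    obtain ⟨p, hp, hpz⟩ := H ε hε
    have h1 : |p.1| ≤ ε • e.1 := by
      have h := hpz.1
      change |0 - p.1| ≤ ε • e.1 at h
      rwa [zero_sub, abs_neg] at h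
    have h2 : |p.2| ≤ ε • e.2 :=
      abs_snd_le_of_abs_fst_le T hp (Submodule.smul_mem _ ε he) h1
    have h3 : |z - p.2| ≤ ε • e.2 := hpz.2
    have h4 : |z| ≤ ε • (e.2 + e.2) := by
      rw [smul_add, ← sub_add_cancel z p.2]
      exact (abs_add_le _ _).trans (add_le_add h3 h2)
    refine (norm_le_norm_of_abs_le_abs (h4.trans (le_abs_self _))).trans_eq ?_
    rw [norm_smul, Real.norm_of_nonneg hε.le]
  have hlim : Tendsto (fun ε : ℝ => ε * ‖e.2 + e.2‖) (𝓝[>] 0) (𝓝 0) := by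
    have : Tendsto (fun ε : ℝ => ε * ‖e.2 + e.2‖) (𝓝 0) (𝓝 (0 * ‖e.2 + e.2‖)) :=
      tendsto_id.mul_const _
    rw [zero_mul] at this
    exact this.mono_left nhdsWithin_le_nhds
  exact norm_le_zero_iff.1 (ge_of_tendsto hlim (eventually_nhdsWithin_of_forall key))

theorem exists_mem_closedGraph (T : E →ₗ[ℝ] X) (a : FreeFun E) : ∃ z, (a, z) ∈ closedGraph T := by
  obtain ⟨m, h, x, rfl⟩ := exists_eq_calculus a
  set L := (deltaGraph T).vectorSublattice with hLdef
  have hL : IsSublattice (L : Set (FreeFun E × X)) := Submodule.isSublattice_vectorSublattice _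
  have hδ : ∀ x, (delta x, T x) ∈ L := fun x => Submodule.le_vectorSublattice _ ⟨x, rfl⟩
  set Φ := calculus fun i => delta (x i)
  have hΦ : IsFunctionCalculus (fun i => delta (x i)) Φ := isFunctionCalculus_calculus _
  -- The functions with a partner in `L` form a sublattice that contains the coordinates.
  let P : Submodule ℝ (PosHom m) := (L.map (LinearMap.fst ℝ (FreeFun E) X)).comap Φ
  have hP : IsSublattice (P : Set (PosHom m)) := by
    constructor
    · rintro p ⟨v, hv, hvp⟩ q ⟨w, hw, hwq⟩
      refine ⟨v ⊔ w, hL.supClosed hv hw, ?_⟩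
      rw [hΦ.isLatticeHom.map_sup, ← hvp, ← hwq]
      rfl
    · rintro p ⟨v, hv, hvp⟩ q ⟨w, hw, hwq⟩
      refine ⟨v ⊓ w, hL.infClosed hv hw, ?_⟩
      rw [hΦ.isLatticeHom.map_inf, ← hvp, ← hwq]
      rfl
  have hproj : ∀ k, PosHom.proj k ∈ P := fun k => ⟨_, hδ (x k), rfl⟩
  set e : FreeFun E × X := ∑ i, |(delta (x i), T (x i))| with he
  have heL : e ∈ L := Submodule.sum_mem _ fun i _ => hL.abs_mem (hδ (x i))
  have he1 : e.1 = Φ (∑ i, |(PosHom.proj i : PosHom m)|) := by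
    rw [hΦ.map_sum_abs_proj, he, Prod.fst_sum]
    rfl
  have happrox : ∀ ε : ℝ, 0 < ε → ∃ w ∈ L, |Φ h - w.1| ≤ ε • e.1 := fun ε hε => by
    obtain ⟨p, ⟨w, hw, hwp⟩, hle⟩ := PosHom.exists_mem_abs_sub_le P hP hproj h hε
    refine ⟨w, hw, ?_⟩
    rw [show w.1 = Φ p from hwp, ← map_sub, ← hΦ.isLatticeHom.map_abs, he1, ← map_smul]
    exact hΦ.isLatticeHom.mono hle
  have hε : ∀ n : ℕ, (0 : ℝ) < 1 / (n + 1) := fun n => Nat.one_div_pos_of_nat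
  -- Positivity on `L` makes the second components of the approximants a Cauchy sequence.
  choose w hwL hw using fun n : ℕ => happrox (1 / (n + 1)) (hε n)
  have hdiff : ∀ n k : ℕ,
      |(w n).2 - (w k).2| ≤ ((1 / (n + 1) : ℝ) + 1 / (k + 1)) • e.2 := fun n k => by
    refine abs_snd_le_of_abs_fst_le T (w := w n - w k) (e := ((1 / (n + 1) : ℝ) + 1 / (k + 1)) • e)
      (Submodule.sub_mem _ (hwL n) (hwL k)) (Submodule.smul_mem _ _ heL) ?_
    calc |(w n).1 - (w k).1| = |(Φ h - (w k).1) - (Φ h - (w n).1)| := by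
          congr 1; abel
      _ ≤ |Φ h - (w k).1| + |Φ h - (w n).1| := by
          rw [sub_eq_add_neg, ← abs_neg (Φ h - (w n).1)]
          exact abs_add_le _ _
      _ ≤ ((1 / (n + 1) : ℝ) + 1 / (k + 1)) • e.1 := by
          rw [add_smul, add_comm]
          exact add_le_add (hw n) (hw k)
  have hlim := tendsto_one_div_add_atTop_nhds_zero_nat (𝕜 := ℝ)
  have hcauchy : CauchySeq fun n => (w n).2 := by
    refine cauchySeq_of_le_tendsto_0 (fun n : ℕ => (1 / (n + 1) + 1 / (n + 1) : ℝ) * ‖e.2‖)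
      (fun n k N hn hk => ?_) ?_
    · rw [dist_eq_norm]
      refine (norm_le_norm_of_abs_le_abs ((hdiff n k).trans (le_abs_self _))).trans ?_
      have h1 := hε n
      have h2 := hε k
      rw [norm_smul, Real.norm_of_nonneg (by positivity)]
      gcongr
    · simpa using (hlim.add hlim).mul_const ‖e.2‖
  obtain ⟨z, hz⟩ := cauchySeq_tendsto_of_complete hcauchy
  have hzle : ∀ n : ℕ, |z - (w n).2| ≤ (1 / (n + 1) : ℝ) • e.2 := fun n => by
    have h1 : Tendsto (fun k => |(w k).2 - (w n).2|) atTop (𝓝 |z - (w n).2|) :=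
      (hz.sub_const _).sup_nhds (hz.sub_const _).neg
    have h2 : Tendsto (fun k : ℕ => ((1 / (k + 1) : ℝ) + 1 / (n + 1)) • e.2) atTop
        (𝓝 ((1 / (n + 1) : ℝ) • e.2)) := by
      simpa using (hlim.add_const (1 / (n + 1) : ℝ)).smul_const e.2
    exact le_of_tendsto_of_tendsto' h1 h2 fun k => hdiff k n
  have he0 : 0 ≤ e := Finset.sum_nonneg fun i _ => abs_nonneg _
  refine ⟨z, e, heL, fun ε hε' => ?_⟩
  obtain ⟨n, hn⟩ := exists_nat_one_div_lt hε'
  exact ⟨w n, hwL n, (hw n).trans (smul_le_smul_of_nonneg_right hn.le he0.1),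
    (hzle n).trans (smul_le_smul_of_nonneg_right hn.le he0.2)⟩

/-- Every linear map from `E` to a Banach lattice extends to a lattice homomorphism on
`FreeFun E`. -/
theorem exists_latticeHom (T : E →ₗ[ℝ] X) :
    ∃ S : FreeFun E →ₗ[ℝ] X, IsLatticeHom S ∧ ∀ x, S (delta x) = T x := by
  choose S hS using exists_mem_closedGraph T
  have huniq : ∀ a z, (a, z) ∈ closedGraph T → S a = z := fun a z hz => by
    have h1 := Submodule.sub_mem _ (hS a) hz
    rw [Prod.mk_sub_mk, sub_self] at h1
    exact sub_eq_zero.1 (eq_zero_of_mem_closedGraph T h1)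
  have hadd : ∀ a b, S (a + b) = S a + S b := fun a b => by
    have h := Submodule.add_mem _ (hS a) (hS b)
    rw [Prod.mk_add_mk] at h
    exact huniq _ _ h
  have hsmul : ∀ (c : ℝ) a, S (c • a) = c • S a := fun c a => by
    have h := Submodule.smul_mem _ c (hS a)
    rw [Prod.smul_mk] at h
    exact huniq _ _ h
  have hsup : ∀ a b, S (a ⊔ b) = S a ⊔ S b := fun a b => by
    have h := (isSublattice_closedGraph T).supClosed (hS a) (hS b)
    rw [Prod.mk_sup_mk] at h
    exact huniq _ _ h
  have hinf : ∀ a b, S (a ⊓ b) = S a ⊓ S b := fun a b => by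
    have h := (isSublattice_closedGraph T).infClosed (hS a) (hS b)
    rw [Prod.mk_inf_mk] at h
    exact huniq _ _ h
  exact ⟨{ toFun := S, map_add' := hadd, map_smul' := hsmul }, ⟨hsup, hinf⟩,
    fun x => huniq _ _ (delta_mem_closedGraph T x)⟩

end FreeFun

/-! ### The largest convex lattice seminorm -/

namespace IsLatticeSeminorm

variable {X Y : Type*} [AddCommGroup X] [Module ℝ X] [Lattice X] [AddCommGroup Y] [Module ℝ Y]
  [Lattice Y]

theorem comp {ν : Seminorm ℝ Y} (hν : IsLatticeSeminorm ν) {S : X →ₗ[ℝ] Y} (hS : IsLatticeHom S) :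
    IsLatticeSeminorm (ν.comp S) := fun x y h => hν _ _ (by
  rw [← hS.map_abs, ← hS.map_abs]
  exact hS.mono h)

theorem smul {ν : Seminorm ℝ X} (hν : IsLatticeSeminorm ν) (c : NNReal) :
    IsLatticeSeminorm (c • ν) :=
  fun x y h => mul_le_mul_of_nonneg_left (hν x y h) c.2

theorem norm {X : Type*} [NormedAddCommGroup X] [NormedSpace ℝ X] [Lattice X] [HasSolidNorm X] :
    IsLatticeSeminorm (normSeminorm ℝ X) :=
  fun _ _ h => norm_le_norm_of_abs_le_abs h

end IsLatticeSeminorm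

section freeSeminorms

variable {E : Type*} [NormedAddCommGroup E] [NormedSpace ℝ E] (D : ConvexityCondition)

theorem comp_evalAt_mem_freeSeminorms (f : DualBall E) :
    (normSeminorm ℝ ℝ).comp (FreeFun.evalAt f) ∈ freeSeminorms E D :=
  ⟨IsLatticeSeminorm.norm.comp (FreeFun.isLatticeHom_evalAt f),
    D.isConvex_real.comp (FreeFun.isLatticeHom_evalAt f), fun x =>
    f.1.le_of_opNorm_le (mem_closedBall_zero_iff.1 f.2) x |>.trans_eq (one_mul _)⟩

theorem nonempty_freeSeminorms : (freeSeminorms E D).Nonempty :=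
  ⟨_, comp_evalAt_mem_freeSeminorms D ⟨0, Metric.mem_closedBall_self zero_le_one⟩⟩

theorem exists_freeSeminorms_le (a : FreeFun E) : ∃ C : ℝ, ∀ ν ∈ freeSeminorms E D, ν a ≤ C := by
  obtain ⟨m, h, x, rfl⟩ := FreeFun.exists_eq_calculus a
  obtain ⟨C, hC, hle⟩ := PosHom.exists_abs_le h
  have hΦ := FreeFun.isFunctionCalculus_calculus fun i => FreeFun.delta (x i)
  have h1 := hΦ.isLatticeHom.mono hle
  rw [map_smul, hΦ.map_sum_abs_proj, hΦ.isLatticeHom.map_abs] at h1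
  refine ⟨C * ∑ i, ‖x i‖, fun ν hν => ?_⟩
  calc _ ≤ ν (C • ∑ i, |FreeFun.delta (x i)|) := hν.1 _ _ (h1.trans (le_abs_self _))
    _ = C * ν (∑ i, |FreeFun.delta (x i)|) := by
      rw [map_smul_eq_mul, Real.norm_of_nonneg hC]
    _ ≤ C * ∑ i, ‖x i‖ := by
      refine mul_le_mul_of_nonneg_left ?_ hC
      refine (Finset.le_sum_of_subadditive ν (map_zero ν).le (map_add_le_add ν) _ _).trans
        (Finset.sum_le_sum fun i _ => ?_)
      exact (hν.1 _ _ (abs_abs _).le).trans (hν.2.2 (x i))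

theorem bddAbove_freeSeminorms : BddAbove (freeSeminorms E D) := by
  choose C hC using exists_freeSeminorms_le (E := E) D
  exact Seminorm.bddAbove_iff.2 ⟨C, by rintro _ ⟨ν, hν, rfl⟩ a; exact hC a ν hν⟩

theorem sSup_freeSeminorms_le {a : FreeFun E} {c : ℝ} (h : ∀ ν ∈ freeSeminorms E D, ν a ≤ c) :
    sSup (freeSeminorms E D) a ≤ c := by
  have := (nonempty_freeSeminorms (E := E) D).to_subtype
  rw [Seminorm.sSup_apply (bddAbove_freeSeminorms D)]
  exact ciSup_le fun ν => h ν ν.2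

theorem le_sSup_freeSeminorms {ν : Seminorm ℝ (FreeFun E)} (h : ν ∈ freeSeminorms E D) :
    ν ≤ sSup (freeSeminorms E D) :=
  le_csSup (bddAbove_freeSeminorms D) h

/-- The supremum of all admissible seminorms is admissible; convexity survives because the
functions of a convexity condition are monotone on the positive orthant. -/
theorem isGreatest_sSup_freeSeminorms :
    IsGreatest (freeSeminorms E D) (sSup (freeSeminorms E D)) := by
  refine ⟨⟨fun a b h => ?_, fun g x hx hdisj Φ hΦ => ?_, fun x => ?_⟩,
    fun ν hν => le_sSup_freeSeminorms D hν⟩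
  · exact sSup_freeSeminorms_le D fun ν hν => (hν.1 a b h).trans (le_sSup_freeSeminorms D hν b)
  · refine sSup_freeSeminorms_le D fun ν hν => (hν.2.1 g x hx hdisj Φ hΦ).trans ?_
    exact mul_le_mul_of_nonneg_left (D.monotone g g.2 _ _ (fun i => apply_nonneg ν _)
      fun i => le_sSup_freeSeminorms D hν _) (zero_le_one.trans (D.one_le g))
  · exact sSup_freeSeminorms_le D fun ν hν => hν.2.2 x

theorem abs_apply_le_sSup_freeSeminorms (a : FreeFun E) (f : DualBall E) :
    |a.1 f| ≤ sSup (freeSeminorms E D) a :=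
  le_sSup_freeSeminorms D (comp_evalAt_mem_freeSeminorms D f) a

theorem eq_zero_of_sSup_freeSeminorms_eq_zero {a : FreeFun E}
    (h : sSup (freeSeminorms E D) a = 0) : a = 0 :=
  Subtype.ext (funext fun f =>
    abs_nonpos_iff.1 ((abs_apply_le_sSup_freeSeminorms D a f).trans_eq h))

theorem sSup_freeSeminorms_delta (x : E) :
    sSup (freeSeminorms E D) (FreeFun.delta x) = ‖x‖ := by
  refine le_antisymm ((isGreatest_sSup_freeSeminorms D).1.2.2 x) ?_
  obtain ⟨f, hf, hfx⟩ := exists_dual_vector'' ℝ x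
  have h := abs_apply_le_sSup_freeSeminorms D (FreeFun.delta x)
    ⟨f, mem_closedBall_zero_iff.2 hf⟩
  change |f x| ≤ _ at h
  rw [hfx] at h
  simpa using h

/-- A lattice homomorphism into a `D`-convex Banach lattice is bounded on `FreeFun E` by its bound
on the evaluations. -/
theorem norm_le_mul_sSup_freeSeminorms {X : Type*} [NormedAddCommGroup X] [NormedSpace ℝ X]
    [Lattice X] [HasSolidNorm X] (hX : D.IsConvex (normSeminorm ℝ X)) {S : FreeFun E →ₗ[ℝ] X}
    (hS : IsLatticeHom S) {c : ℝ} (hc : 0 ≤ c) (h : ∀ x, ‖S (FreeFun.delta x)‖ ≤ c * ‖x‖)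
    (a : FreeFun E) : ‖S a‖ ≤ c * sSup (freeSeminorms E D) a := by
  -- Dividing by `C > c` instead of `c` covers `c = 0`.
  have key : ∀ C : ℝ, c < C → ‖S a‖ ≤ C * sSup (freeSeminorms E D) a := fun C hC => by
    have hC0 : 0 < C := hc.trans_lt hC
    let k : NNReal := ⟨C⁻¹, (inv_pos.2 hC0).le⟩
    have hmem : k • (normSeminorm ℝ X).comp S ∈
        freeSeminorms E D := by
      refine ⟨(IsLatticeSeminorm.norm.comp hS).smul _, (hX.comp hS).smul, fun x => ?_⟩
      change C⁻¹ * ‖S (FreeFun.delta x)‖ ≤ ‖x‖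
      rw [inv_mul_le_iff₀ hC0]
      exact (h x).trans (mul_le_mul_of_nonneg_right hC.le (norm_nonneg x))
    have h1 : C⁻¹ * ‖S a‖ ≤ sSup (freeSeminorms E D) a := le_sSup_freeSeminorms D hmem a
    rwa [inv_mul_le_iff₀ hC0] at h1
  have hlim : Tendsto (fun C : ℝ => C * sSup (freeSeminorms E D) a) (𝓝[>] c)
      (𝓝 (c * sSup (freeSeminorms E D) a)) :=
    (tendsto_id.mul_const _ : Tendsto _ (𝓝 c) _).mono_left nhdsWithin_le_nhds
  exact ge_of_tendsto hlim (eventually_nhdsWithin_of_forall key)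

end freeSeminorms

/-! ### Automatic continuity -/

/-- Lattice homomorphisms from a Banach lattice to a normed lattice are bounded. Otherwise there
is a summable sequence of positive elements with unbounded images, and the image of its sum
dominates all of these. -/
theorem IsLatticeHom.continuous {F X : Type*} [NormedAddCommGroup F] [NormedSpace ℝ F] [Lattice F]
    [BanachLattice F] [NormedAddCommGroup X] [NormedSpace ℝ X] [Lattice X] [IsOrderedAddMonoid X]
    [HasSolidNorm X] {U : F →ₗ[ℝ] X} (hU : IsLatticeHom U) : Continuous U := by
  by_contra hcon
  have h : ∀ n : ℕ, ∃ x, ((n : ℝ) * 2 ^ n) * ‖x‖ < ‖U x‖ := fun n => by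
    by_contra! hb
    exact hcon (U.mkContinuous _ hb).continuous
  choose x hx using h
  have hx0 : ∀ n, 0 < ‖x n‖ := fun n => by
    refine norm_pos_iff.2 fun h0 => ?_
    have := hx n
    simp [h0] at this
  set c : ℕ → ℝ := fun n => (2 ^ n * ‖x n‖)⁻¹ with hc
  have hc0 : ∀ n, 0 < c n := fun n => inv_pos.2 (mul_pos (by positivity) (hx0 n))
  set y : ℕ → F := fun n => c n • |x n| with hy
  have hy0 : ∀ n, 0 ≤ y n := fun n => smul_nonneg (hc0 n).le (abs_nonneg _)
  have hynorm : ∀ n, ‖y n‖ = (1 / 2) ^ n := fun n => by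
    rw [hy, norm_smul, norm_abs_eq_norm, Real.norm_of_nonneg (hc0 n).le]
    have := (hx0 n).ne'
    simp only [hc, one_div, inv_pow]
    field_simp
  have hsum : Summable y := Summable.of_norm (by
    simpa only [hynorm] using summable_geometric_two)
  have hle : ∀ n : ℕ, (n : ℝ) ≤ ‖U (∑' k, y k)‖ := fun n => by
    have h1 : U (y n) ≤ U (∑' k, y k) := hU.mono (hsum.le_tsum n fun k _ => hy0 k)
    have h2 : 0 ≤ U (y n) := by simpa using hU.mono (hy0 n)
    have h3 : ‖U (y n)‖ = c n * ‖U (x n)‖ := by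
      rw [hy, map_smul, hU.map_abs, norm_smul, norm_abs_eq_norm, Real.norm_of_nonneg (hc0 n).le]
    calc (n : ℝ) = c n * ((n : ℝ) * 2 ^ n * ‖x n‖) := by
          have := (hx0 n).ne'
          simp only [hc]
          field_simp
      _ ≤ ‖U (y n)‖ := h3 ▸ mul_le_mul_of_nonneg_left (hx n).le (hc0 n).le
      _ ≤ ‖U (∑' k, y k)‖ := norm_le_norm_of_abs_le_abs (by
          rw [abs_of_nonneg h2, abs_of_nonneg (h2.trans h1)]
          exact h1)
  obtain ⟨n, hn⟩ := exists_nat_gt ‖U (∑' k, y k)‖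
  exact (hle n).not_gt hn

/-- A continuous linear map that is a lattice homomorphism on a dense sublattice is one. -/
theorem IsLatticeHom.of_denseRange {Y F X : Type*} [AddCommGroup Y] [Module ℝ Y] [Lattice Y]
    [NormedAddCommGroup F] [NormedSpace ℝ F] [Lattice F] [IsOrderedAddMonoid F] [HasSolidNorm F]
    [NormedAddCommGroup X] [NormedSpace ℝ X] [Lattice X] [IsOrderedAddMonoid X] [HasSolidNorm X]
    {ι : Y →ₗ[ℝ] F} (hι : IsLatticeHom ι) (hd : DenseRange ι) {T : F →L[ℝ] X}
    (hT : IsLatticeHom ((T : F →ₗ[ℝ] X) ∘ₗ ι)) : IsLatticeHom (T : F →ₗ[ℝ] X) := by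
  constructor
  · intro x y
    refine hd.induction_on₂ (p := fun x y => T (x ⊔ y) = T x ⊔ T y)
      (isClosed_eq (by fun_prop) (by fun_prop)) (fun a b => ?_) x y
    rw [← hι.map_sup]
    exact hT.map_sup a b
  · intro x y
    refine hd.induction_on₂ (p := fun x y => T (x ⊓ y) = T x ⊓ T y)
      (isClosed_eq (by fun_prop) (by fun_prop)) (fun a b => ?_) x y
    rw [← hι.map_inf]
    exact hT.map_inf a b

/-! ### The free convex Banach lattice -/

theorem theorem3p3 (E : Type u) [NormedAddCommGroup E] [NormedSpace ℝ E] [CompleteSpace E]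
    (D : ConvexityCondition) :
    ∃ (F : Type u) (_ : NormedAddCommGroup F) (_ : NormedSpace ℝ F) (_ : Lattice F)
      (_ : BanachLattice F) (φ : E →ₗᵢ[ℝ] F),
      D.IsConvex (normSeminorm ℝ F) ∧
      -- the universal property
      (∀ (X : Type v) [NormedAddCommGroup X] [NormedSpace ℝ X] [Lattice X] [BanachLattice X],
        D.IsConvex (normSeminorm ℝ X) →
        ∀ T : E →L[ℝ] X, ∃ That : F →L[ℝ] X,
          IsLatticeHom (That : F →ₗ[ℝ] X) ∧ (∀ x, That (φ x) = T x) ∧ ‖That‖ = ‖T‖ ∧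
          ∀ U : F →ₗ[ℝ] X, IsLatticeHom U → (∀ x, U (φ x) = T x) → U = That) ∧
      -- `F` is the completion of `FreeFun E` in its largest `D`-convex lattice norm with
      -- `‖δ_x‖ ≤ ‖x‖`, and `φ x = δ_x`
      (∃ ι : FreeFun E →ₗ[ℝ] F, IsLatticeHom ι ∧ Function.Injective ι ∧ DenseRange ι ∧
        (∀ x, ι (FreeFun.delta x) = φ x) ∧
        IsGreatest (freeSeminorms E D) ((normSeminorm ℝ F).comp ι)) := by
  have hgreatest := isGreatest_sSup_freeSeminorms (E := E) D
  obtain ⟨F, _, _, _, _, ι, hι, hd, hnorm⟩ := exists_banachLattice_completion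
    (sSup (freeSeminorms E D)) hgreatest.1.1 fun _ => eq_zero_of_sSup_freeSeminorms_eq_zero D
  have hcomp : (normSeminorm ℝ F).comp ι = sSup (freeSeminorms E D) := Seminorm.ext hnorm
  let φ : E →ₗᵢ[ℝ] F :=
    ⟨ι ∘ₗ FreeFun.deltaₗ, fun x => (hnorm _).trans (sSup_freeSeminorms_delta D x)⟩
  refine ⟨F, ‹_›, ‹_›, ‹_›, ‹_›, φ, ?_, ?_, ι, hι, ?_, hd, fun _ => rfl, hcomp ▸ hgreatest⟩
  · exact ConvexityCondition.IsConvex.of_denseRange hι hd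
      (fun _ y => ⟨_, FreeFun.isFunctionCalculus_calculus y⟩) (hcomp ▸ hgreatest.1.2.1)
  · intro X _ _ _ _ hX T
    obtain ⟨S, hS, hST⟩ := FreeFun.exists_latticeHom (T : E →ₗ[ℝ] X)
    have hbound : ∀ a, ‖S a‖ ≤ ‖T‖ * ‖ι a‖ := fun a => hnorm a ▸
      norm_le_mul_sSup_freeSeminorms D hX hS (norm_nonneg T) (fun x => hST x ▸ T.le_opNorm x) a
    have heq : ∀ a, S.extendOfNorm ι (ι a) = S a := LinearMap.extendOfNorm_eq hd ⟨_, hbound⟩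
    have hφ : ∀ x, S.extendOfNorm ι (φ x) = T x := fun x => (heq _).trans (hST x)
    refine ⟨S.extendOfNorm ι, .of_denseRange hι hd ?_, hφ, le_antisymm ?_ ?_, fun U hU hUT => ?_⟩
    · rwa [show (S.extendOfNorm ι : F →ₗ[ℝ] X) ∘ₗ ι = S from LinearMap.ext heq]
    · exact LinearMap.opNorm_extendOfNorm_le hd (norm_nonneg T) hbound
    · refine T.opNorm_le_bound (norm_nonneg _) fun x => ?_
      rw [← hφ, ← φ.norm_map x]
      exact ContinuousLinearMap.le_opNorm _ _
    · have hUS : U ∘ₗ ι = S := FreeFun.hom_ext (hU.comp hι) hS fun x => (hUT x).trans (hST x).symm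
      refine LinearMap.coe_injective (hd.equalizer hU.continuous (S.extendOfNorm ι).continuous ?_)
      exact funext fun a => (LinearMap.congr_fun hUS a).trans (heq a).symm
  · refine (injective_iff_map_eq_zero ι).2 fun a ha => eq_zero_of_sSup_freeSeminorms_eq_zero D ?_
    rw [← hnorm, ha, norm_zero]
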